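/- For $j\in\{0,\tfrac12,1,\tfrac32,\dots\}$ let $V^j$ denote the irreducible complex representation of $\mathrm{SU}(2)$ of spin $j$, of dimension $2j+1$. For a spin $s\in\{\tfrac12,1,\tfrac32,\dots\}$ and $n\ge 0$ let ${}^s d^{(n)}_j$ be the multiplicities in the decomposition into irreducibles $$\bigotimes^n V^s\;\cong\;\bigoplus_{j} {}^s d^{(n)}_j\,V^j .$$ Such a decomposition exists for every $n$, and the maximum $\max_j {}^s d^{(n)}_j$ is attained. There are constants $c(s)>0$ and $C(s)>0$, depending only on $s$, such that for every choice, for each $n$, of a spin $j_{\max}=j_{\max}(n)$ with ${}^s d^{(n)}_{j_{\max}}=\max_j {}^s d^{(n)}_j$, one has $$ j_{\max}\;\sim\; c(s)\,\sqrt n ,\qquad {}^s d^{(n)}_{j_{\max}}\;\sim\; C(s)\,\frac{(2s+1)^n}{n}\qquad (n\to\infty),$$ where $a_n\sim b_n$ means that $a_n/b_n\to 1$. Both proportionality constants really depend on $s$: neither $c$ nor $C$ is a constant function of $s$. -/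

import Mathlib

open Filter Asymptotics
open scoped TensorProduct DirectSum

/-- The group `SU(2)`. -/
abbrev SU2 : Type := Matrix.specialUnitaryGroup (Fin 2) ℂ

/-- The space of the irreducible representation of `SU(2)` of spin `k / 2`: complex homogeneous
polynomials of degree `k` in two variables. Spins are indexed by their doubles `k = 2j`. -/
abbrev SpinSpace (k : ℕ) : Type := MvPolynomial.homogeneousSubmodule (Fin 2) ℂ k

/-- The linear substitution `X i ↦ ∑ l, g l i • X l`, that is, `g` acting on the basis
`X 0, X 1` of `ℂ²` and extended multiplicatively. -/
noncomputable def linSubst (g : Matrix (Fin 2) (Fin 2) ℂ) :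
    MvPolynomial (Fin 2) ℂ →ₐ[ℂ] MvPolynomial (Fin 2) ℂ :=
  MvPolynomial.aeval fun i => ∑ l, g l i • MvPolynomial.X l

lemma linSubst_one : linSubst 1 = AlgHom.id ℂ _ := by
  refine MvPolynomial.algHom_ext fun i => ?_
  simp [linSubst, Matrix.one_apply, ite_smul]

lemma linSubst_mul (g h : Matrix (Fin 2) (Fin 2) ℂ) :
    linSubst (g * h) = (linSubst g).comp (linSubst h) := by
  refine MvPolynomial.algHom_ext fun i => ?_
  simp only [linSubst, MvPolynomial.aeval_X, AlgHom.comp_apply, Matrix.mul_apply,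
    Fin.sum_univ_two, map_add, map_smul]
  module

lemma linSubst_mem (g : Matrix (Fin 2) (Fin 2) ℂ) (k : ℕ) :
    ∀ p ∈ MvPolynomial.homogeneousSubmodule (Fin 2) ℂ k,
      (linSubst g).toLinearMap p ∈ MvPolynomial.homogeneousSubmodule (Fin 2) ℂ k := by
  intro p hp
  rw [MvPolynomial.mem_homogeneousSubmodule] at hp ⊢
  have h := MvPolynomial.IsHomogeneous.aeval hp
    (fun i => ∑ l, g l i • (MvPolynomial.X l : MvPolynomial (Fin 2) ℂ)) (n := 1) (fun i => by
      refine MvPolynomial.IsHomogeneous.sum _ _ _ fun l _ => ?_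
      rw [MvPolynomial.smul_eq_C_mul]
      exact (MvPolynomial.isHomogeneous_X ℂ l).C_mul _)
  simpa [linSubst] using h

/-- The representation `V^j` of `SU(2)` of spin `j = k / 2`, of dimension `2j + 1 = k + 1`:
the `k`-th symmetric power of the standard representation on `ℂ²`. -/
noncomputable def spinRep (k : ℕ) : Representation ℂ SU2 (SpinSpace k) where
  toFun g := (linSubst g).toLinearMap.restrict (linSubst_mem g k)
  map_one' := by
    ext1 p
    apply Subtype.ext
    simp [LinearMap.restrict_apply, linSubst_one]
  map_mul' g h := by
    ext1 p
    apply Subtype.ext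
    simp [LinearMap.restrict_apply, linSubst_mul]

/-- The representation `(V^s)^{⊗ n}` of `SU(2)`, with `s = k / 2`:
`g (v₁ ⊗ ⋯ ⊗ vₙ) = g v₁ ⊗ ⋯ ⊗ g vₙ`. -/
noncomputable def spinTensorPower (k n : ℕ) :
    Representation ℂ SU2 (⨂[ℂ] _ : Fin n, SpinSpace k) where
  toFun g := PiTensorProduct.map fun _ => spinRep k g
  map_one' := by
    simp only [map_one]
    exact PiTensorProduct.map_one
  map_mul' g h := by
    simp only [map_mul]
    exact PiTensorProduct.map_mul _ _

/-- `d j` is, for every `j`, the multiplicity of the spin `j / 2` in `(V^s)^{⊗ n}`, `s = k / 2`: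
as representations of `SU(2)`, `(V^s)^{⊗ n}` is isomorphic to the direct sum over all `j`
of `d j` copies of `V^{j / 2}`. -/
def IsSpinMultiplicity (k n : ℕ) (d : ℕ → ℕ) : Prop :=
  Nonempty ((spinTensorPower k n).Equiv
    (Representation.directSum fun x : (Σ j : ℕ, Fin (d j)) => spinRep x.1))

/-! A copy of `V^{j/2}` has each of its weights once, the highest being `j`, so its multiplicity in
the tensor power is the weight multiplicity at `j` minus that at `j + 2`
(`isSpinMultiplicity_recurrence`). Weights of the tensor power are sums of `n` independent weights,
each uniform on those of `V^s`, with variance `v = s(s+1)/3` in spin units. The weight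
multiplicities are thus asymptotically Gaussian on the scale `√n`, and the multiplicities follow the
derivative of a Gaussian: with `x = (j+1)/(2√(vn))` and `j` of the parity of `nk`, `d j * n /
(2s+1)^n` is close to `C x e^{(1-x²)/2}`. This profile has its unique maximum, `1`, at `x = 1`,
whence `c = √v` and `C = 1/(v√(2πe))`.

A limit theorem for each weight multiplicity separately would be too coarse to subtract. The
difference is instead a single Fourier integral of `χⁿ sin((j+1)t/2) sin(t/2)`, where the factor
`sin(t/2)` supplies the extra `1/√n`. After rescaling, the part free of `j` converges in L¹, so the
error is uniform in `j` (`exists_tendsto_zero_multiplicity_error`). Uniformity fixes the maximal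
value, and the shape of the profile then forces `x → 1` along any choice of maximisers
(`tendsto_one_of_mul_exp`).

Existence of the decomposition rests on the Clebsch–Gordan step `clebschGordan_bijective`: Cayley's
operator and multiplication of forms together split off the top spin of a tensor product. -/

open Topology

/-! ### Binary forms and their monomial basis -/

/-- The exponent of the monomial `X₀ ^ (k - i) * X₁ ^ i`. -/
noncomputable def spinExp (k i : ℕ) : Fin 2 →₀ ℕ := Finsupp.single 0 (k - i) + Finsupp.single 1 i

lemma spinExp_one (k i : ℕ) : spinExp k i 1 = i := by simp [spinExp]

lemma spinExp_zero (k i : ℕ) : spinExp k i 0 = k - i := by simp [spinExp]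

lemma spinExp_inj {k i j : ℕ} : spinExp k i = spinExp k j ↔ i = j :=
  ⟨fun h => by simpa [spinExp_one] using DFunLike.congr_fun h 1, fun h => h ▸ rfl⟩

lemma spinExp_degree {k i : ℕ} (h : i ≤ k) : (spinExp k i).degree = k := by
  rw [Finsupp.degree_eq_sum, Fin.sum_univ_two, spinExp_zero, spinExp_one]; omega

lemma eq_spinExp_of_degree {k : ℕ} {d : Fin 2 →₀ ℕ} (h : d.degree = k) :
    d = spinExp k (d 1) ∧ d 1 ≤ k := by
  rw [Finsupp.degree_eq_sum, Fin.sum_univ_two] at h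
  refine ⟨Finsupp.ext fun i => ?_, by omega⟩
  fin_cases i
  · simp only [Fin.zero_eta, spinExp_zero]; omega
  · simp [spinExp_one]

/-- A binary form is determined by its `k + 1` coefficients. -/
noncomputable def spinCoeffEquiv (k : ℕ) : SpinSpace k ≃ₗ[ℂ] (Fin (k + 1) → ℂ) where
  toFun p i := (p : MvPolynomial (Fin 2) ℂ).coeff (spinExp k i)
  map_add' p q := by ext; simp
  map_smul' c p := by ext; simp
  invFun a := ⟨∑ i : Fin (k + 1), MvPolynomial.monomial (spinExp k i) (a i),
    Submodule.sum_mem _ fun i _ => MvPolynomial.isHomogeneous_monomial _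
      (spinExp_degree (Nat.lt_succ_iff.1 i.2))⟩
  left_inv p := by
    apply Subtype.ext
    ext d
    simp only [MvPolynomial.coeff_sum, MvPolynomial.coeff_monomial]
    by_cases hd : d.degree = k
    · obtain ⟨h1, h2⟩ := eq_spinExp_of_degree hd
      rw [Finset.sum_eq_single ⟨d 1, Nat.lt_succ_iff.2 h2⟩]
      · simp [← h1]
      · intro b _ hb
        rw [if_neg]
        intro h
        apply hb
        ext
        simp [← h, spinExp_one]
      · simp
    · rw [MvPolynomial.IsHomogeneous.coeff_eq_zero (n := k) p.2 hd]
      refine Finset.sum_eq_zero fun i _ => if_neg ?_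
      rintro rfl
      exact hd (spinExp_degree (Nat.lt_succ_iff.1 i.2))
  right_inv a := by
    ext j
    simp [MvPolynomial.coeff_sum, MvPolynomial.coeff_monomial, spinExp_inj, Fin.val_inj]

/-- The basis of monomials. -/
noncomputable def spinBasis (k : ℕ) : Module.Basis (Fin (k + 1)) ℂ (SpinSpace k) :=
  Module.Basis.ofEquivFun (spinCoeffEquiv k)

lemma spinBasis_repr (k : ℕ) (p : SpinSpace k) (i : Fin (k + 1)) :
    (spinBasis k).repr p i = (p : MvPolynomial (Fin 2) ℂ).coeff (spinExp k i) := rfl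

lemma spinBasis_coe (k : ℕ) (i : Fin (k + 1)) :
    (spinBasis k i : MvPolynomial (Fin 2) ℂ) = MvPolynomial.monomial (spinExp k i) 1 := by
  rw [spinBasis, Module.Basis.coe_ofEquivFun]
  change ∑ j : Fin (k + 1), MvPolynomial.monomial (spinExp k j) ((Pi.single i (1:ℂ) : _ → ℂ) j) = _
  rw [Finset.sum_eq_single i]
  · simp
  · intro j _ hj; simp [hj]
  · simp

instance (k : ℕ) : Module.Finite ℂ (SpinSpace k) := Module.Finite.of_basis (spinBasis k)

lemma finrank_spinSpace (k : ℕ) : Module.finrank ℂ (SpinSpace k) = k + 1 := by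
  simp [Module.finrank_eq_card_basis (spinBasis k)]

/-! ### Torus weights and the weight count of a decomposition -/

/-- The diagonal element `diag(e^{i}, e^{-i})`, which generates a dense subgroup of the torus. -/
noncomputable def torusElt : SU2 :=
  ⟨Matrix.diagonal ![Complex.exp Complex.I, Complex.exp (-Complex.I)], by
    rw [Matrix.mem_specialUnitaryGroup_iff, Matrix.mem_unitaryGroup_iff]
    constructor
    · rw [Matrix.star_eq_conjTranspose, Matrix.diagonal_conjTranspose, Matrix.diagonal_mul_diagonal,
        ← Matrix.diagonal_one]
      congr 1
      ext i
      fin_cases i <;> simp [← Complex.exp_conj, ← Complex.exp_add]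
    · simp [Matrix.det_diagonal, ← Complex.exp_add]⟩

/-- Two equal powers would make `π` rational. Hence one group element separates all weights, and
eigenspace dimensions of `torusElt` replace characters. -/
lemma exp_I_zpow_inj {a b : ℤ} :
    Complex.exp Complex.I ^ a = Complex.exp Complex.I ^ b ↔ a = b := by
  refine ⟨fun h => ?_, fun h => h ▸ rfl⟩
  rw [← Complex.exp_int_mul, ← Complex.exp_int_mul, Complex.exp_eq_exp_iff_exists_int] at h
  obtain ⟨n, hn⟩ := h
  have h1 : (a : ℝ) = b + n * (2 * Real.pi) := by
    have := congrArg Complex.im hn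
    simpa using this
  by_contra hab
  have hn0 : n ≠ 0 := by
    rintro rfl
    apply hab
    exact_mod_cast (by simpa using h1 : (a : ℝ) = b)
  refine irrational_pi ⟨(a - b) / (2 * n), ?_⟩
  have : (n : ℝ) ≠ 0 := by exact_mod_cast hn0
  push_cast
  field_simp
  linarith

lemma spinRep_torusElt (k : ℕ) (i : Fin (k + 1)) :
    spinRep k torusElt (spinBasis k i)
      = Complex.exp Complex.I ^ ((k : ℤ) - 2 * (i : ℕ)) • spinBasis k i := by
  apply Subtype.ext
  change linSubst torusElt.1 (spinBasis k i : MvPolynomial (Fin 2) ℂ) = _ • (spinBasis k i).1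
  rw [spinBasis_coe, linSubst, MvPolynomial.aeval_monomial, Finsupp.prod_fintype _ _ (by simp)]
  simp only [Fin.sum_univ_two, Fin.prod_univ_two, spinExp_zero, spinExp_one, torusElt]
  simp only [Matrix.diagonal_apply]
  simp only [Matrix.cons_val_zero, Matrix.cons_val_one, if_true, Fin.isValue,
    one_ne_zero, zero_ne_one, if_false, zero_smul, add_zero, zero_add, smul_pow, map_one, one_mul]
  rw [MvPolynomial.monomial_eq, Finsupp.prod_fintype _ _ (by simp)]
  simp only [Fin.prod_univ_two, spinExp_zero, spinExp_one, map_one, one_mul]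
  rw [smul_mul_smul_comm]
  congr 1
  rw [Complex.exp_neg, inv_pow, ← zpow_natCast, ← zpow_natCast, ← zpow_neg,
    ← zpow_add₀ (Complex.exp_ne_zero _)]
  congr 1
  have := i.2
  omega

/-- The dimension of an eigenspace of an operator that is diagonal in a basis. -/
lemma finrank_eigenspace_of_basis {ι V : Type*} [AddCommGroup V] [Module ℂ V]
    [Finite ι] (b : Module.Basis ι ℂ V) (T : V →ₗ[ℂ] V) (μ : ι → ℂ) (h : ∀ i, T (b i) = μ i • b i)
    (c : ℂ) :
    Module.finrank ℂ (Module.End.eigenspace T c) = Nat.card {i // μ i = c} := by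
  have := Fintype.ofFinite ι
  classical
  have hli : LinearIndependent ℂ (fun i : {i // μ i = c} => b i) :=
    b.linearIndependent.comp _ Subtype.val_injective
  rw [Nat.card_eq_fintype_card, ← finrank_span_eq_card hli]
  suffices Module.End.eigenspace T c =
      Submodule.span ℂ (Set.range fun i : {i // μ i = c} => b i) by rw [this]
  apply le_antisymm
  · intro v hv
    rw [Module.End.mem_eigenspace_iff] at hv
    rw [← b.sum_repr v]
    refine Submodule.sum_mem _ fun i _ => ?_
    by_cases hi : μ i = c
    · exact Submodule.smul_mem _ _ (Submodule.subset_span ⟨⟨i, hi⟩, rfl⟩)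
    · have h1 : b.repr (T v) i = μ i * b.repr v i := by
        conv_lhs => rw [← b.sum_repr v]
        simp only [map_sum, map_smul, h, Module.Basis.repr_self, Finsupp.coe_finsetSum,
          Finset.sum_apply, Finsupp.smul_apply, Finsupp.single_apply, smul_eq_mul, mul_ite,
          mul_one, mul_zero, Finset.sum_ite_eq', Finset.mem_univ, if_true]
        ring
      rw [hv, map_smul, Finsupp.smul_apply, smul_eq_mul] at h1
      have h2 : (μ i - c) * b.repr v i = 0 := by
        linear_combination -h1
      rcases mul_eq_zero.1 h2 with h3 | h3
      · exact absurd (sub_eq_zero.1 h3) hi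
      · simp [h3]
  · rw [Submodule.span_le]
    rintro _ ⟨⟨i, hi⟩, rfl⟩
    simp [h, hi]

/-- The number of ways to write the weight `m` as a sum of `n` weights of `V^{k/2}`. -/
noncomputable def weightMult (k n : ℕ) (m : ℤ) : ℕ :=
  Nat.card {f : Fin n → Fin (k + 1) // ∑ i, ((k : ℤ) - 2 * (f i : ℕ)) = m}

lemma spinTensorPower_torusElt (k n : ℕ) (f : Fin n → Fin (k + 1)) :
    spinTensorPower k n torusElt (Basis.piTensorProduct (fun _ => spinBasis k) f)
      = Complex.exp Complex.I ^ (∑ i, ((k : ℤ) - 2 * (f i : ℕ))) •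
        Basis.piTensorProduct (fun _ => spinBasis k) f := by
  rw [Basis.piTensorProduct_apply]
  change PiTensorProduct.map _ _ = _
  rw [PiTensorProduct.map_tprod]
  simp only [spinRep_torusElt]
  rw [MultilinearMap.map_smul_univ]
  congr 1
  induction (Finset.univ : Finset (Fin n)) using Finset.induction_on with
  | empty => simp
  | insert a s ha ih =>
    rw [Finset.prod_insert ha, Finset.sum_insert ha, zpow_add₀ (Complex.exp_ne_zero _), ih]

lemma dfinsupp_basis_apply {ι R : Type*} [Semiring R] {M : ι → Type*} [DecidableEq ι]
    [∀ i, AddCommMonoid (M i)] [∀ i, Module R (M i)] {η : ι → Type*}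
    (b : ∀ i, Module.Basis (η i) R (M i)) (x : Σ i, η i) :
    DFinsupp.basis b x = DFinsupp.single x.1 (b x.1 x.2) := by
  obtain ⟨i, a⟩ := x
  classical
  rw [Module.Basis.apply_eq_iff]
  simp only [DFinsupp.basis, LinearEquiv.trans_apply]
  rw [LinearEquiv.symm_apply_eq]
  simp

lemma finrank_eigenspace_equiv {G V W : Type*} [Monoid G] [AddCommGroup V] [Module ℂ V]
    [AddCommGroup W] [Module ℂ W] {ρ : Representation ℂ G V} {σ : Representation ℂ G W}
    (e : ρ.Equiv σ) (g : G) (c : ℂ) :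
    Module.finrank ℂ (Module.End.eigenspace (ρ g) c) =
      Module.finrank ℂ (Module.End.eigenspace (σ g) c) := by
  have h : Module.End.eigenspace (σ g) c =
      (Module.End.eigenspace (ρ g) c).map e.toLinearEquiv.toLinearMap := by
    ext w
    simp only [Submodule.mem_map, Module.End.mem_eigenspace_iff]
    constructor
    · intro hw
      refine ⟨e.symm w, ?_, e.apply_symm_apply w⟩
      exact ((Representation.IntertwiningMap.isIntertwining _ _ e.symm.toIntertwiningMap g w).symm.trans
        (congrArg e.symm hw)).trans (e.symm.toLinearEquiv.map_smul c w)
    · rintro ⟨v, hv, rfl⟩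
      exact ((Representation.IntertwiningMap.isIntertwining _ _ e.toIntertwiningMap g v).symm.trans
        (congrArg e hv)).trans (e.toLinearEquiv.map_smul c v)
  rw [h]
  exact (LinearEquiv.finrank_map_eq e.toLinearEquiv _).symm

lemma directSum_spinRep_torusElt {ι : Type*} [DecidableEq ι] (f : ι → ℕ)
    (x : Σ i, Fin (f i + 1)) :
    Representation.directSum (fun i => spinRep (f i)) torusElt
        (DFinsupp.basis (fun i => spinBasis (f i)) x) =
      Complex.exp Complex.I ^ ((f x.1 : ℤ) - 2 * (x.2 : ℕ)) •
        DFinsupp.basis (fun i => spinBasis (f i)) x := by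
  have h : DFinsupp.basis (fun i => spinBasis (f i)) x =
      DirectSum.lof ℂ _ (fun i => SpinSpace (f i)) x.1 (spinBasis (f x.1) x.2) :=
    dfinsupp_basis_apply _ x
  rw [h, Representation.directSum_apply]
  erw [DirectSum.lmap_lof]
  rw [spinRep_torusElt, map_smul]

/-- Both sides are the dimension of one eigenspace of `torusElt`, read in the tensor basis and in
the basis of the direct sum. Finiteness must be deduced, since nothing in the definition bounds the
support of `d`; without it `Nat.card` could be a junk zero. -/
lemma isSpinMultiplicity_card {k n : ℕ} {d : ℕ → ℕ} (h : IsSpinMultiplicity k n d) :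
    Finite (Σ x : (Σ j : ℕ, Fin (d j)), Fin (x.1 + 1)) ∧ ∀ m : ℤ,
    weightMult k n m = Nat.card {x : (Σ x : (Σ j : ℕ, Fin (d j)), Fin (x.1 + 1)) //
      (x.1.1 : ℤ) - 2 * (x.2 : ℕ) = m} := by
  obtain ⟨e⟩ := h
  have : Module.Finite ℂ (⨂[ℂ] _ : Fin n, SpinSpace k) :=
    Module.Finite.of_basis (Basis.piTensorProduct (fun _ : Fin n => spinBasis k))
  have : Module.Finite ℂ (⨁ x : (Σ j : ℕ, Fin (d j)), SpinSpace x.1) :=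
    Module.Finite.equiv e.toLinearEquiv
  let b2 : Module.Basis (Σ x : (Σ j : ℕ, Fin (d j)), Fin (x.1 + 1)) ℂ
    (⨁ x : (Σ j : ℕ, Fin (d j)), SpinSpace x.1) := DFinsupp.basis fun x => spinBasis x.1
  have hfin := Module.Finite.finite_basis b2
  refine ⟨hfin, fun m => ?_⟩
  have h1 := finrank_eigenspace_of_basis (V := ⨂[ℂ] _ : Fin n, SpinSpace k)
    (Basis.piTensorProduct (fun _ : Fin n => spinBasis k)) (spinTensorPower k n torusElt)
    (fun f : Fin n → Fin (k + 1) => Complex.exp Complex.I ^ (∑ i, ((k : ℤ) - 2 * (f i : ℕ))))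
    (spinTensorPower_torusElt k n) (Complex.exp Complex.I ^ m)
  have h2 := finrank_eigenspace_of_basis (V := ⨁ x : (Σ j : ℕ, Fin (d j)), SpinSpace x.1) b2
    (Representation.directSum (fun x : (Σ j : ℕ, Fin (d j)) => spinRep x.1) torusElt)
    (fun x : (Σ x : (Σ j : ℕ, Fin (d j)), Fin (x.1 + 1)) =>
      Complex.exp Complex.I ^ ((x.1.1 : ℤ) - 2 * (x.2 : ℕ)))
    (fun x => directSum_spinRep_torusElt _ x) (Complex.exp Complex.I ^ m)
  have h3 := finrank_eigenspace_equiv (V := ⨂[ℂ] _ : Fin n, SpinSpace k)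
    (W := ⨁ x : (Σ j : ℕ, Fin (d j)), SpinSpace x.1) e torusElt (Complex.exp Complex.I ^ m)
  simp only [exp_I_zpow_inj] at h1 h2
  exact h1.symm.trans (h3.trans h2)

lemma isSpinMultiplicity_recurrence {k n : ℕ} {d : ℕ → ℕ} (h : IsSpinMultiplicity k n d) (j : ℕ) :
    weightMult k n j = d j + weightMult k n (j + 2) := by
  obtain ⟨hfin, hc⟩ := isSpinMultiplicity_card h
  rw [hc, hc]
  -- A copy of `V^{j/2}` goes to its highest weight vector; a basis vector of weight `j + 2` goes to
  -- the next one of the same summand. Index `0` versus a positive index tells the two cases apart.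
  let φ : Fin (d j) ⊕ {x : (Σ x : (Σ j : ℕ, Fin (d j)), Fin (x.1 + 1)) //
      (x.1.1 : ℤ) - 2 * (x.2 : ℕ) = j + 2} → {x : (Σ x : (Σ j : ℕ, Fin (d j)), Fin (x.1 + 1)) //
      (x.1.1 : ℤ) - 2 * (x.2 : ℕ) = j} := Sum.elim (fun a => ⟨⟨⟨j, a⟩, 0⟩, by simp⟩)
        (fun x => ⟨⟨x.1.1, ⟨x.1.2 + 1, by have := x.2; omega⟩⟩, by
          have := x.2; push_cast; omega⟩)
  have hφ : Function.Bijective φ := by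
    constructor
    · rintro (a | ⟨⟨⟨j1, a1⟩, i1⟩, h1⟩) (b | ⟨⟨⟨j2, a2⟩, i2⟩, h2⟩) hab
      · simpa [φ] using hab
      · have := congrArg (fun y => (y.1.2 : ℕ)) hab
        simp [φ] at this
      · have := congrArg (fun y => (y.1.2 : ℕ)) hab
        simp [φ] at this
      · simp only [φ, Sum.elim_inr, Subtype.mk.injEq, Sigma.mk.injEq] at hab
        obtain ⟨⟨rfl, h⟩, hab⟩ := hab
        simp only [heq_eq_eq] at h
        subst h
        simp only [heq_eq_eq, Fin.mk.injEq, Nat.add_right_cancel_iff, Fin.val_inj] at hab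
        subst hab
        rfl
    · rintro ⟨⟨⟨j1, a1⟩, ⟨i1, hi⟩⟩, h1⟩
      rcases i1 with _ | i
      · have : j1 = j := by simpa using h1
        subst this
        exact ⟨Sum.inl a1, rfl⟩
      · exact ⟨Sum.inr ⟨⟨⟨j1, a1⟩, ⟨i, by omega⟩⟩, by push_cast at h1 ⊢; omega⟩, rfl⟩
  rw [← Nat.card_congr (Equiv.ofBijective φ hφ), Nat.card_sum]
  simp

/-! ### Cayley's operator and the Clebsch–Gordan step -/

lemma pderiv_mem_homogeneousSubmodule (i : Fin 2) (k : ℕ) :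
    ∀ p ∈ MvPolynomial.homogeneousSubmodule (Fin 2) ℂ (k + 1),
      (MvPolynomial.pderiv i).toLinearMap p ∈ MvPolynomial.homogeneousSubmodule (Fin 2) ℂ k := by
  intro p hp d hd
  change MvPolynomial.coeff d (MvPolynomial.pderiv i p) ≠ 0 at hd
  rw [MvPolynomial.coeff_pderiv] at hd
  have h := hp (left_ne_zero_of_mul hd)
  rw [map_add] at h
  simpa [Finsupp.weight_single] using h

/-- Partial derivatives lower the degree of a form by one. -/
noncomputable def spinDeriv (i : Fin 2) (k : ℕ) : SpinSpace (k + 1) →ₗ[ℂ] SpinSpace k :=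
  (MvPolynomial.pderiv i).toLinearMap.restrict (pderiv_mem_homogeneousSubmodule i k)

lemma spinDeriv_coe (i : Fin 2) (k : ℕ) (p : SpinSpace (k + 1)) :
    (spinDeriv i k p : MvPolynomial (Fin 2) ℂ) = MvPolynomial.pderiv i p := rfl

/-- The chain rule for a linear substitution. The gradient transforms by `g`, so the antisymmetric
combination in Cayley's operator is multiplied by `det g = 1`. -/
lemma pderiv_linSubst (g : Matrix (Fin 2) (Fin 2) ℂ) (l : Fin 2) (p : MvPolynomial (Fin 2) ℂ) :
    MvPolynomial.pderiv l (linSubst g p) =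
      ∑ i, g l i • linSubst g (MvPolynomial.pderiv i p) := by
  induction p using MvPolynomial.induction_on with
  | C a => simp [linSubst]
  | add p q hp hq => simp only [map_add, hp, hq, smul_add, Finset.sum_add_distrib]
  | mul_X p j hp =>
    have hX : linSubst g (MvPolynomial.X j) = ∑ m, g m j • MvPolynomial.X m := by
      rw [linSubst, MvPolynomial.aeval_X]
    simp only [map_mul, MvPolynomial.pderiv_mul, hp, map_add, hX]
    fin_cases j <;> fin_cases l <;>
      simp [Fin.sum_univ_two, MvPolynomial.pderiv_X, Pi.single_apply, MvPolynomial.smul_eq_C_mul]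
        <;> ring

lemma spinDeriv_spinRep (g : SU2) (l : Fin 2) (k : ℕ) (p : SpinSpace (k + 1)) :
    spinDeriv l k (spinRep (k + 1) g p) = ∑ i, g.1 l i • spinRep k g (spinDeriv i k p) := by
  apply Subtype.ext
  rw [spinDeriv_coe, AddSubmonoidClass.coe_finsetSum]
  exact pderiv_linSubst g.1 l p

/-- Cayley's operator `∂₀ ⊗ ∂₁ - ∂₁ ⊗ ∂₀`. -/
noncomputable def cayleyOmega (k l : ℕ) :
    ((spinRep (k + 1)).tprod (spinRep (l + 1))).IntertwiningMap ((spinRep k).tprod (spinRep l)) where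
  toLinearMap := TensorProduct.map (spinDeriv 0 k) (spinDeriv 1 l) +
    (-1 : ℂ) • TensorProduct.map (spinDeriv 1 k) (spinDeriv 0 l)
  isIntertwining' g := by
    ext1
    ext1 p
    ext1 q
    have hdet : g.1 0 0 * g.1 1 1 - g.1 0 1 * g.1 1 0 = 1 := by
      rw [← Matrix.det_fin_two]
      exact (Matrix.mem_specialUnitaryGroup_iff.1 g.2).2
    simp only [TensorProduct.AlgebraTensorModule.curry_apply, TensorProduct.curry_apply,
      LinearMap.coe_restrictScalars, LinearMap.comp_apply, Representation.tprod_apply,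
      TensorProduct.map_tmul, LinearMap.add_apply, LinearMap.smul_apply, spinDeriv_spinRep, Fin.sum_univ_two, map_add, map_smul,
      TensorProduct.add_tmul, TensorProduct.tmul_add, TensorProduct.smul_tmul_smul]
    generalize (spinRep k g) (spinDeriv 0 k p) = a0
    generalize (spinRep k g) (spinDeriv 1 k p) = a1
    generalize (spinRep l g) (spinDeriv 0 l q) = b0
    generalize (spinRep l g) (spinDeriv 1 l q) = b1
    have h1 : a0 ⊗ₜ[ℂ] b1 + (-1 : ℂ) • a1 ⊗ₜ[ℂ] b0 =
      (g.1 0 0 * g.1 1 1 - g.1 0 1 * g.1 1 0) • (a0 ⊗ₜ[ℂ] b1 + (-1 : ℂ) • a1 ⊗ₜ[ℂ] b0) := by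
      rw [hdet, one_smul]
    rw [h1]
    module

/-- Multiplication of binary forms. -/
noncomputable def spinMul (k l : ℕ) :
    ((spinRep k).tprod (spinRep l)).IntertwiningMap (spinRep (k + l)) where
  toLinearMap := TensorProduct.lift (LinearMap.mk₂ ℂ
    (fun p q => (⟨p.1 * q.1, MvPolynomial.IsHomogeneous.mul p.2 q.2⟩ : SpinSpace (k + l)))
    (fun _ _ _ => Subtype.ext (add_mul _ _ _)) (fun _ _ _ => Subtype.ext (smul_mul_assoc _ _ _))
    (fun _ _ _ => Subtype.ext (mul_add _ _ _)) (fun _ _ _ => Subtype.ext (mul_smul_comm _ _ _)))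
  isIntertwining' g := by
    ext1
    ext1 p
    ext1 q
    apply Subtype.ext
    exact (map_mul (linSubst g.1) p.1 q.1).symm

lemma spinMul_tmul (k l : ℕ) (p : SpinSpace k) (q : SpinSpace l) :
    (spinMul k l (p ⊗ₜ q) : MvPolynomial (Fin 2) ℂ) = p.1 * q.1 := rfl

/-- The coefficients of an element of `V^{k/2} ⊗ V^{l/2}` in the basis of monomials, extended by
zero. -/
noncomputable def tensorCoeff (k l : ℕ) (p q : ℕ) : SpinSpace k ⊗[ℂ] SpinSpace l →ₗ[ℂ] ℂ :=
  LinearMap.mul' ℂ ℂ ∘ₗ TensorProduct.map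
    ((MvPolynomial.lcoeff ℂ (spinExp k p)).domRestrict _)
    ((MvPolynomial.lcoeff ℂ (spinExp l q)).domRestrict _)

lemma tensorCoeff_tmul (k l p q : ℕ) (x : SpinSpace k) (y : SpinSpace l) :
    tensorCoeff k l p q (x ⊗ₜ y) = x.1.coeff (spinExp k p) * y.1.coeff (spinExp l q) := rfl

lemma spinExp_add_single_zero {k p : ℕ} (h : p ≤ k) :
    spinExp k p + Finsupp.single 0 1 = spinExp (k + 1) p := by
  ext i; fin_cases i
  · simp [spinExp]; omega
  · simp [spinExp]

lemma spinExp_add_single_one {k p : ℕ} :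
    spinExp k p + Finsupp.single 1 1 = spinExp (k + 1) (p + 1) := by
  ext i; fin_cases i
  · simp [spinExp]
  · simp [spinExp]

lemma spinDeriv_zero_coeff {k p : ℕ} (h : p ≤ k) (x : SpinSpace (k + 1)) :
    (spinDeriv 0 k x).1.coeff (spinExp k p) =
      ((k + 1 - p : ℕ) : ℂ) * x.1.coeff (spinExp (k + 1) p) := by
  rw [spinDeriv_coe, MvPolynomial.coeff_pderiv, spinExp_add_single_zero h, spinExp_zero,
    Nat.sub_add_comm h]
  push_cast
  ring

lemma spinDeriv_one_coeff {k p : ℕ} (x : SpinSpace (k + 1)) :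
    (spinDeriv 1 k x).1.coeff (spinExp k p) =
      ((p + 1 : ℕ) : ℂ) * x.1.coeff (spinExp (k + 1) (p + 1)) := by
  rw [spinDeriv_coe, MvPolynomial.coeff_pderiv, spinExp_add_single_one, spinExp_one]
  push_cast
  ring

/-- Each coefficient of the image involves only two neighbours on an antidiagonal, so the kernel of
the operator is given by two-term relations. -/
lemma tensorCoeff_cayleyOmega {k l p q : ℕ} (hp : p ≤ k) (hq : q ≤ l)
    (F : SpinSpace (k + 1) ⊗[ℂ] SpinSpace (l + 1)) :
    tensorCoeff k l p q (cayleyOmega k l F) =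
      ((k + 1 - p : ℕ) : ℂ) * (q + 1 : ℕ) * tensorCoeff (k + 1) (l + 1) p (q + 1) F -
      ((p + 1 : ℕ) : ℂ) * (l + 1 - q : ℕ) * tensorCoeff (k + 1) (l + 1) (p + 1) q F := by
  induction F with
  | zero => simp
  | add x y hx hy => simp only [map_add, hx, hy]; ring
  | tmul x y =>
    change tensorCoeff k l p q (spinDeriv 0 k x ⊗ₜ spinDeriv 1 l y +
      (-1 : ℂ) • spinDeriv 1 k x ⊗ₜ spinDeriv 0 l y) = _
    simp only [map_add, map_smul, smul_eq_mul, tensorCoeff_tmul, spinDeriv_zero_coeff hp, spinDeriv_zero_coeff hq,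
      spinDeriv_one_coeff]
    ring

lemma eq_sum_tensorCoeff {k l : ℕ} (F : SpinSpace k ⊗[ℂ] SpinSpace l) :
    F = ∑ i : Fin (k + 1), ∑ j : Fin (l + 1),
      tensorCoeff k l i j F • (spinBasis k i ⊗ₜ[ℂ] spinBasis l j) := by
  induction F with
  | zero => simp
  | add x y hx hy =>
    simp only [map_add, add_smul, Finset.sum_add_distrib]
    rw [← hx, ← hy]
  | tmul x y =>
    conv_lhs => rw [← (spinBasis k).sum_repr x, ← (spinBasis l).sum_repr y]
    simp only [TensorProduct.sum_tmul, TensorProduct.tmul_sum, tensorCoeff_tmul, spinBasis_repr,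
      TensorProduct.smul_tmul_smul]
    exact Finset.sum_comm

lemma spinExp_add_spinExp {k l p q : ℕ} (hp : p ≤ k) (hq : q ≤ l) :
    spinExp k p + spinExp l q = spinExp (k + l) (p + q) := by
  ext i; fin_cases i
  · simp [spinExp]; omega
  · simp [spinExp]

lemma spinMul_coeff {k l : ℕ} (F : SpinSpace k ⊗[ℂ] SpinSpace l) (w : ℕ) :
    (spinMul k l F).1.coeff (spinExp (k + l) w) =
      ∑ i : Fin (k + 1), ∑ j : Fin (l + 1), if (i + j : ℕ) = w then tensorCoeff k l i j F else 0 := by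
  have h : ∀ i j, (spinMul k l (spinBasis k i ⊗ₜ[ℂ] spinBasis l j)).1.coeff (spinExp (k + l) w) =
      if (i + j : ℕ) = w then 1 else 0 := by
    intro i j
    rw [spinMul_tmul, spinBasis_coe, spinBasis_coe, MvPolynomial.monomial_mul,
      spinExp_add_spinExp (Nat.lt_succ_iff.1 i.2) (Nat.lt_succ_iff.1 j.2),
      MvPolynomial.coeff_monomial]
    simp [spinExp_inj]
  let L : SpinSpace k ⊗[ℂ] SpinSpace l →ₗ[ℂ] ℂ :=
    ((MvPolynomial.lcoeff ℂ (spinExp (k + l) w)).domRestrict _) ∘ₗ (spinMul k l).toLinearMap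
  have hL : ∀ F, L F = (spinMul k l F).1.coeff (spinExp (k + l) w) := fun F => rfl
  conv_lhs => rw [← hL, eq_sum_tensorCoeff F]
  simp only [map_sum, map_smul]
  simp only [hL, h, smul_eq_mul, mul_ite, mul_one, mul_zero]

/-- An element of `V^{k/2} ⊗ V^{l/2}` killed by multiplication vanishes if its normalised
coefficients are constant on antidiagonals. -/
lemma eq_zero_of_spinMul_eq_zero {k l : ℕ} (F : SpinSpace k ⊗[ℂ] SpinSpace l)
    (hmul : spinMul k l F = 0)
    (h : ∀ p q, p + 1 ≤ k → q + 1 ≤ l →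
      ((k - p : ℕ) : ℂ) * (q + 1 : ℕ) * tensorCoeff k l p (q + 1) F =
      ((p + 1 : ℕ) : ℂ) * (l - q : ℕ) * tensorCoeff k l (p + 1) q F) : F = 0 := by
  set a : ℕ → ℕ → ℂ := fun p q => tensorCoeff k l p q F with ha
  -- Dividing by binomials turns the two-term relation into equality of neighbours.
  set b : ℕ → ℕ → ℂ := fun p q => a p q / (k.choose p * l.choose q) with hb
  have hch : ∀ {k p : ℕ}, p ≤ k → (k.choose p : ℂ) ≠ 0 := fun h => by
    exact_mod_cast (Nat.choose_pos h).ne'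
  have hab : ∀ p q, p ≤ k → q ≤ l → a p q = k.choose p * l.choose q * b p q := by
    intro p q hp hq
    have := hch hp
    have := hch hq
    simp only [hb]
    field_simp
  have hstep : ∀ p q, p + 1 ≤ k → q + 1 ≤ l → b p (q + 1) = b (p + 1) q := by
    intro p q hp hq
    have h1 := h p q hp hq
    change _ * _ * a _ _ = _ * _ * a _ _ at h1
    rw [hab _ _ (by omega) hq, hab _ _ hp (by omega)] at h1
    have e1 : ((k.choose (p + 1) : ℕ) : ℂ) * (p + 1 : ℕ) = k.choose p * (k - p : ℕ) := by
      exact_mod_cast Nat.choose_succ_right_eq k p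
    have e2 : ((l.choose (q + 1) : ℕ) : ℂ) * (q + 1 : ℕ) = l.choose q * (l - q : ℕ) := by
      exact_mod_cast Nat.choose_succ_right_eq l q
    have n1 : ((k - p : ℕ) : ℂ) ≠ 0 := by exact_mod_cast (by omega : k - p ≠ 0)
    have n2 : ((l - q : ℕ) : ℂ) ≠ 0 := by exact_mod_cast (by omega : l - q ≠ 0)
    have n3 := hch (show p ≤ k by omega)
    have n4 := hch (show q ≤ l by omega)
    apply mul_left_cancel₀ (mul_ne_zero (mul_ne_zero n1 n2) (mul_ne_zero n3 n4))
    linear_combination h1 - (k - p : ℕ) * k.choose p * b p (q + 1) * e2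
      + (l - q : ℕ) * l.choose q * b (p + 1) q * e1
  have hshift : ∀ t p q, p + t ≤ k → q + t ≤ l → b p (q + t) = b (p + t) q := by
    intro t
    induction t with
    | zero => intros; rfl
    | succ t ih =>
      intro p q hp hq
      rw [← add_assoc, hstep p (q + t) (by omega) (by omega), ih (p + 1) q (by omega) (by omega)]
      congr 1
      omega
  have hconst : ∀ p q p' q', p ≤ k → q ≤ l → p' ≤ k → q' ≤ l → p + q = p' + q' →
      b p q = b p' q' := by
    have hwlog : ∀ p q p' q', p ≤ k → q ≤ l → p' ≤ k → q' ≤ l → p + q = p' + q' → p ≤ p' →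
        b p q = b p' q' := by
      intro p q p' q' _ _ _ _ hs hle
      have := hshift (p' - p) p q' (by omega) (by omega)
      rwa [show q' + (p' - p) = q by omega, show p + (p' - p) = p' by omega] at this
    intro p q p' q' h1 h2 h3 h4 hs
    rcases le_total p p' with hle | hle
    · exact hwlog _ _ _ _ h1 h2 h3 h4 hs hle
    · exact (hwlog _ _ _ _ h3 h4 h1 h2 hs.symm hle).symm
  have hb0 : ∀ p q, p ≤ k → q ≤ l → b p q = 0 := by
    intro p q hp hq
    have h1 := spinMul_coeff F (p + q)
    -- With `b` constant on the antidiagonal, the product's coefficient is `b p q` times a sum of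
    -- natural numbers, positive because of its term at `(p, q)`.
    have h2 : (∑ i : Fin (k + 1), ∑ j : Fin (l + 1),
        if (i + j : ℕ) = p + q then tensorCoeff k l i j F else 0) =
        ((∑ i : Fin (k + 1), ∑ j : Fin (l + 1),
        if (i + j : ℕ) = p + q then k.choose i * l.choose j else 0 : ℕ) : ℂ) * b p q := by
      push_cast
      rw [Finset.sum_mul]
      refine Finset.sum_congr rfl fun i _ => ?_
      rw [Finset.sum_mul]
      refine Finset.sum_congr rfl fun j _ => ?_
      have hi := Nat.lt_succ_iff.1 i.2
      have hj := Nat.lt_succ_iff.1 j.2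
      split_ifs with hij
      · change a i j = _
        rw [hab _ _ hi hj, hconst _ _ p q hi hj hp hq hij]
      · simp
    rw [h2, hmul] at h1
    have h3 : (0 : ℂ) = _ * b p q := h1
    rcases mul_eq_zero.1 h3.symm with h4 | h4
    · exfalso
      rw [Nat.cast_eq_zero, Finset.sum_eq_zero_iff] at h4
      have h5 := h4 ⟨p, Nat.lt_succ_iff.2 hp⟩ (Finset.mem_univ _)
      rw [Finset.sum_eq_zero_iff] at h5
      have h6 := h5 ⟨q, Nat.lt_succ_iff.2 hq⟩ (Finset.mem_univ _)
      simp only [if_true] at h6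
      exact (Nat.mul_pos (Nat.choose_pos hp) (Nat.choose_pos hq)).ne' h6
    · exact h4
  rw [eq_sum_tensorCoeff F]
  refine Finset.sum_eq_zero fun i _ => Finset.sum_eq_zero fun j _ => ?_
  have hi := Nat.lt_succ_iff.1 i.2
  have hj := Nat.lt_succ_iff.1 j.2
  have : a i j = 0 := by rw [hab _ _ hi hj, hb0 _ _ hi hj, mul_zero]
  change a i j • _ = _
  rw [this, zero_smul]

lemma bijective_of_finrank_eq {V W : Type*} [AddCommMonoid V] [Module ℂ V] [AddCommMonoid W]
    [Module ℂ W] [Module.Finite ℂ V] [Module.Finite ℂ W] (T : V →ₗ[ℂ] W)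
    (h : ∀ v, T v = 0 → v = 0) (hd : Module.finrank ℂ V = Module.finrank ℂ W) :
    Function.Bijective T := by
  -- Scalar multiplication by `-1` recovers the subtraction that the kernel criterion and the
  -- dimension count need.
  let _ := Module.addCommMonoidToAddCommGroup ℂ (M := V)
  let _ := Module.addCommMonoidToAddCommGroup ℂ (M := W)
  have hinj : Function.Injective T := by
    rw [← LinearMap.ker_eq_bot, LinearMap.ker_eq_bot']
    exact h
  exact ⟨hinj, (LinearMap.injective_iff_surjective_of_finrank_eq_finrank hd).1 hinj⟩

/-- The Clebsch–Gordan decomposition, one step at a time. -/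
lemma clebschGordan_bijective (k l : ℕ) : Function.Bijective
    (fun F : SpinSpace (k + 1) ⊗[ℂ] SpinSpace (l + 1) =>
      (cayleyOmega k l F, spinMul (k + 1) (l + 1) F)) := by
  let T : SpinSpace (k + 1) ⊗[ℂ] SpinSpace (l + 1) →ₗ[ℂ]
      (SpinSpace k ⊗[ℂ] SpinSpace l) × SpinSpace (k + 1 + (l + 1)) :=
    (cayleyOmega k l).toLinearMap.prod (spinMul (k + 1) (l + 1)).toLinearMap
  refine bijective_of_finrank_eq T (fun F hF => ?_) ?_
  · have h1 : cayleyOmega k l F = 0 := congrArg Prod.fst hF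
    refine eq_zero_of_spinMul_eq_zero F (congrArg Prod.snd hF) fun p q hp hq => ?_
    have h2 := tensorCoeff_cayleyOmega (Nat.le_of_succ_le_succ hp) (Nat.le_of_succ_le_succ hq) F
    rw [h1, map_zero] at h2
    exact sub_eq_zero.1 h2.symm
  -- The count is `(k+2)(l+2) = (k+1)(l+1) + (k+l+3)`.
  · simp only [Module.finrank_prod, Module.finrank_tensorProduct, finrank_spinSpace]
    ring

/-- When one factor is trivial, antidiagonals have a single entry and the relations are vacuous.
This ends the Clebsch–Gordan recursion. -/
lemma spinMul_bijective_of_zero {k l : ℕ} (h : k = 0 ∨ l = 0) :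
    Function.Bijective (spinMul k l) := by
  refine bijective_of_finrank_eq (spinMul k l).toLinearMap (fun F hF =>
    eq_zero_of_spinMul_eq_zero F hF fun p q hp hq => by omega) ?_
  simp only [Module.finrank_tensorProduct, finrank_spinSpace]
  rcases h with rfl | rfl <;> simp

/-! ### Decomposition of tensor powers into spins -/

/-- A representation of `SU(2)` that decomposes as a finite direct sum of the `V^{j/2}`. -/
def IsSpinSum {V : Type*} [AddCommMonoid V] [Module ℂ V] (ρ : Representation ℂ SU2 V) : Prop :=
  ∃ (ι : Type) (_ : Fintype ι) (f : ι → ℕ) (φ : ∀ i, ρ.IntertwiningMap (spinRep (f i))),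
    Function.Bijective fun (v : V) (i : ι) => φ i v

lemma isSpinSum_spinRep (k : ℕ) : IsSpinSum (spinRep k) :=
  ⟨Unit, inferInstance, fun _ => k, fun _ => Representation.IntertwiningMap.id _,
    fun _ _ h => congrFun h (), fun y => ⟨y (), rfl⟩⟩

section

variable {V W U : Type*} [AddCommMonoid V] [Module ℂ V] [AddCommMonoid W] [Module ℂ W]
  [AddCommMonoid U] [Module ℂ U] {ρ : Representation ℂ SU2 V} {σ : Representation ℂ SU2 W}
  {τ : Representation ℂ SU2 U}

lemma IsSpinSum.of_bijective (h : IsSpinSum σ) (ψ : ρ.IntertwiningMap σ)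
    (hψ : Function.Bijective ψ) : IsSpinSum ρ := by
  obtain ⟨ι, _, f, φ, hφ⟩ := h
  exact ⟨ι, inferInstance, f, fun i => (φ i).comp ψ, hφ.comp hψ⟩

lemma IsSpinSum.of_bijective_prod (h₁ : IsSpinSum σ) (h₂ : IsSpinSum τ)
    (ψ₁ : ρ.IntertwiningMap σ) (ψ₂ : ρ.IntertwiningMap τ)
    (hψ : Function.Bijective fun v => (ψ₁ v, ψ₂ v)) : IsSpinSum ρ := by
  obtain ⟨ι₁, _, f₁, φ₁, hφ₁⟩ := h₁
  obtain ⟨ι₂, _, f₂, φ₂, hφ₂⟩ := h₂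
  refine ⟨ι₁ ⊕ ι₂, inferInstance, Sum.elim f₁ f₂,
    Sum.rec (fun i => (φ₁ i).comp ψ₁) (fun i => (φ₂ i).comp ψ₂), ?_, ?_⟩
  · intro v w h
    refine hψ.1 (Prod.ext (hφ₁.1 ?_) (hφ₂.1 ?_))
    · exact funext fun i => congrFun h (Sum.inl i)
    · exact funext fun i => congrFun h (Sum.inr i)
  · intro y
    obtain ⟨a, ha⟩ := hφ₁.2 fun i => y (Sum.inl i)
    obtain ⟨b, hb⟩ := hφ₂.2 fun i => y (Sum.inr i)
    obtain ⟨v, hv⟩ := hψ.2 (a, b)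
    have h1 : ψ₁ v = a := congrArg Prod.fst hv
    have h2 : ψ₂ v = b := congrArg Prod.snd hv
    refine ⟨v, funext fun i => ?_⟩
    rcases i with i | i
    · exact (congrArg (φ₁ i) h1).trans (congrFun ha i)
    · exact (congrArg (φ₂ i) h2).trans (congrFun hb i)

lemma IsSpinSum.of_bijective_pi {ι : Type} [Fintype ι] {X : ι → Type*}
    [∀ i, AddCommMonoid (X i)] [∀ i, Module ℂ (X i)] {σ : ∀ i, Representation ℂ SU2 (X i)}
    (h : ∀ i, IsSpinSum (σ i)) (ψ : ∀ i, ρ.IntertwiningMap (σ i))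
    (hψ : Function.Bijective fun v i => ψ i v) : IsSpinSum ρ := by
  choose κ hκ f φ hφ using h
  refine ⟨Σ i, κ i, inferInstance, fun x => f x.1 x.2, fun x => (φ x.1 x.2).comp (ψ x.1), ?_, ?_⟩
  · intro v w h
    exact hψ.1 (funext fun i => (hφ i).1 (funext fun a => congrFun h ⟨i, a⟩))
  · intro y
    choose a ha using fun i => (hφ i).2 fun b => y ⟨i, b⟩
    obtain ⟨v, hv⟩ := hψ.2 a
    refine ⟨v, funext fun x => ?_⟩
    exact (congrArg (φ x.1 x.2) (congrFun hv x.1)).trans (congrFun (ha x.1) x.2)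

/-- Each Clebsch–Gordan step removes the top spin and lowers both degrees by one, until one of them
is zero. -/
lemma IsSpinSum.tprod_spinRep (k l : ℕ) : IsSpinSum ((spinRep k).tprod (spinRep l)) := by
  induction k generalizing l with
  | zero => exact (isSpinSum_spinRep _).of_bijective _ (spinMul_bijective_of_zero (Or.inl rfl))
  | succ k ih =>
    cases l with
    | zero => exact (isSpinSum_spinRep _).of_bijective _ (spinMul_bijective_of_zero (Or.inr rfl))
    | succ l => exact (ih l).of_bijective_prod (isSpinSum_spinRep _) _ _ (clebschGordan_bijective k l)

lemma IsSpinSum.spinRep_tprod (k : ℕ) (h : IsSpinSum ρ) : IsSpinSum ((spinRep k).tprod ρ) := by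
  classical
  obtain ⟨ι, _, f, φ, hφ⟩ := h
  refine IsSpinSum.of_bijective_pi (fun i => IsSpinSum.tprod_spinRep k (f i))
    (fun i => (φ i).lTensor (spinRep k)) ?_
  let e : V ≃ₗ[ℂ] ∀ i, SpinSpace (f i) :=
    LinearEquiv.ofBijective (LinearMap.pi fun i => (φ i).toLinearMap) hφ
  let E := (e.lTensor (SpinSpace k)).trans
    (TensorProduct.piRight ℂ ℂ (SpinSpace k) (fun i => SpinSpace (f i)))
  have hE : (fun v i => (φ i).lTensor (spinRep k) v) = E := by
    funext v
    induction v with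
    | zero => simp only [map_zero]; rfl
    | add x y hx hy =>
      simp only [map_add]
      rw [← hx, ← hy]
      rfl
    | tmul x y => rfl
  rw [hE]
  exact E.bijective

lemma nonempty_equiv_directSum {ι κ : Type} [Fintype κ] {f : ι → ℕ}
    (φ : ∀ i, ρ.IntertwiningMap (spinRep (f i))) (hφ : Function.Bijective fun v i => φ i v)
    (ε : κ ≃ ι) (F : κ → ℕ) (hF : ∀ x, f (ε x) = F x) :
    Nonempty (ρ.Equiv (Representation.directSum fun x => spinRep (F x))) := by
  classical
  obtain rfl : (fun x => f (ε x)) = F := funext hF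
  let P : V →ₗ[ℂ] ∀ x, SpinSpace (f (ε x)) := LinearMap.pi fun x => (φ (ε x)).toLinearMap
  have hP : Function.Bijective P := by
    constructor
    · intro v w h
      refine hφ.1 (funext fun i => ?_)
      obtain ⟨x, rfl⟩ := ε.surjective i
      exact congrFun h x
    · intro y
      obtain ⟨v, hv⟩ := hφ.2 ((Equiv.piCongrLeft (fun i => SpinSpace (f i)) ε) y)
      refine ⟨v, funext fun x => (congrFun hv (ε x)).trans ?_⟩
      exact Equiv.piCongrLeft_apply_apply (fun i => SpinSpace (f i)) ε y x
  let E : V ≃ₗ[ℂ] ⨁ x, SpinSpace (f (ε x)) := (LinearEquiv.ofBijective P hP).trans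
    (DirectSum.linearEquivFunOnFintype ℂ κ fun x => SpinSpace (f (ε x))).symm
  have hE : ∀ v x, E v x = φ (ε x) v := fun v x => rfl
  refine ⟨Representation.Equiv.mk E fun g => ?_⟩
  ext1 v
  refine DFinsupp.ext fun x => ?_
  change E (ρ g v) x = DirectSum.lmap (fun x => spinRep (f (ε x)) g) (E v) x
  rw [DirectSum.lmap_apply, hE, hE]
  exact Representation.IntertwiningMap.isIntertwining _ _ (φ (ε x)) g v

/-- A finite direct sum of spins, reindexed so that equal spins are grouped. -/
lemma IsSpinSum.exists_multiplicity (h : IsSpinSum ρ) : ∃ d : ℕ → ℕ, Nonempty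
    (ρ.Equiv (Representation.directSum fun x : (Σ j : ℕ, Fin (d j)) => spinRep x.1)) := by
  classical
  obtain ⟨ι, _, f, φ, hφ⟩ := h
  refine ⟨fun j => Fintype.card {i // f i = j}, ?_⟩
  let ε : (Σ j : ℕ, Fin (Fintype.card {i // f i = j})) ≃ ι :=
    (Equiv.sigmaCongrRight fun j => (Fintype.equivFin {i // f i = j}).symm).trans
      (Equiv.sigmaFiberEquiv f)
  have hε : ∀ x, f (ε x) = x.1 := fun x =>
    ((Fintype.equivFin {i // f i = x.1}).symm x.2).2
  have := Fintype.ofEquiv ι ε.symm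
  exact nonempty_equiv_directSum φ hφ ε _ hε

end

lemma spinTensorPower_zero_isSpinSum (k : ℕ) : IsSpinSum (spinTensorPower k 0) := by
  let b : Module.Basis (Fin 1) ℂ (⨂[ℂ] _ : Fin 0, SpinSpace k) :=
    (Basis.piTensorProduct (fun _ : Fin 0 => spinBasis k)).reindex (Equiv.ofUnique _ _)
  let e : (⨂[ℂ] _ : Fin 0, SpinSpace k) ≃ₗ[ℂ] SpinSpace 0 := b.equiv (spinBasis 0) (Equiv.refl _)
  have he : ∀ g, e.toLinearMap ∘ₗ spinTensorPower k 0 g = spinRep 0 g ∘ₗ e.toLinearMap := by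
    intro g
    refine b.ext fun i => ?_
    have h1 : spinTensorPower k 0 g (b i) = b i := by
      simp only [b, Module.Basis.reindex_apply, Basis.piTensorProduct_apply]
      change PiTensorProduct.map _ _ = _
      rw [PiTensorProduct.map_tprod]
      congr 1
      exact Subsingleton.elim _ _
    have h2 : spinRep 0 g (spinBasis 0 i) = spinBasis 0 i := by
      apply Subtype.ext
      change linSubst g.1 (spinBasis 0 i).1 = _
      have : spinExp 0 i = 0 := by ext j; fin_cases j <;> simp [spinExp]
      rw [spinBasis_coe, this]
      exact map_one (linSubst g.1)
    have h3 : e (b i) = spinBasis 0 i := b.equiv_apply _ _ _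
    simp only [LinearMap.comp_apply, LinearEquiv.coe_coe]
    rw [h1, h3, h2]
  exact (isSpinSum_spinRep 0).of_bijective ⟨e.toLinearMap, he⟩ e.bijective

lemma isSpinSum_spinTensorPower (k n : ℕ) : IsSpinSum (spinTensorPower k n) := by
  induction n with
  | zero => exact spinTensorPower_zero_isSpinSum k
  | succ n ih =>
    -- The left factor becomes the last tensor slot.
    let e : SpinSpace k ⊗[ℂ] (⨂[ℂ] _ : Fin n, SpinSpace k) ≃ₗ[ℂ]
        ⨂[ℂ] _ : Fin (n + 1), SpinSpace k :=
      (TensorProduct.comm ℂ _ _).trans <|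
      ((PiTensorProduct.subsingletonEquiv (R := ℂ) (s := fun _ : Fin 1 => SpinSpace k)
        (0 : Fin 1)).symm.lTensor _).trans <|
      (PiTensorProduct.tmulEquiv ℂ (SpinSpace k)).trans
      (PiTensorProduct.reindex ℂ (fun _ => SpinSpace k) (finSumFinEquiv (m := n) (n := 1)))
    have he : ∀ g, e.toLinearMap ∘ₗ ((spinRep k).tprod (spinTensorPower k n)) g =
        spinTensorPower k (n + 1) g ∘ₗ e.toLinearMap := by
      intro g
      have hee : ∀ (x : SpinSpace k) (y : Fin n → SpinSpace k), e (x ⊗ₜ PiTensorProduct.tprod ℂ y) =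
          PiTensorProduct.tprod ℂ fun i =>
            Sum.elim y (fun _ => x) ((finSumFinEquiv (m := n) (n := 1)).symm i) := by
        intro x y
        simp only [e, LinearEquiv.trans_apply, TensorProduct.comm_tmul, LinearEquiv.lTensor_tmul]
        rw [PiTensorProduct.subsingletonEquiv_symm_apply, PiTensorProduct.tmulEquiv_apply,
          PiTensorProduct.reindex_tprod]
        congr 1
        funext i
        rcases (finSumFinEquiv (m := n) (n := 1)).symm i with j | j
        · rfl
        · simp [Subsingleton.elim j 0]
      refine TensorProduct.ext (LinearMap.ext fun x => PiTensorProduct.ext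
        (MultilinearMap.ext fun y => ?_))
      change e (spinRep k g x ⊗ₜ PiTensorProduct.map _ (PiTensorProduct.tprod ℂ y)) =
        PiTensorProduct.map _ (e (x ⊗ₜ PiTensorProduct.tprod ℂ y))
      rw [PiTensorProduct.map_tprod, hee, hee, PiTensorProduct.map_tprod]
      congr 1
      funext i
      rcases (finSumFinEquiv (m := n) (n := 1)).symm i with j | j <;> rfl
    have he' : ∀ g, e.symm.toLinearMap ∘ₗ spinTensorPower k (n + 1) g =
        ((spinRep k).tprod (spinTensorPower k n)) g ∘ₗ e.symm.toLinearMap := by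
      intro g
      refine LinearMap.ext fun v => ?_
      obtain ⟨w, rfl⟩ := e.surjective v
      have := LinearMap.congr_fun (he g) w
      simp only [LinearMap.comp_apply, LinearEquiv.coe_coe] at this ⊢
      rw [← this, e.symm_apply_apply, e.symm_apply_apply]
    exact (ih.spinRep_tprod k).of_bijective ⟨e.symm.toLinearMap, he'⟩ e.symm.bijective

lemma exists_isSpinMultiplicity (k n : ℕ) : ∃ d, IsSpinMultiplicity k n d :=
  (isSpinSum_spinTensorPower k n).exists_multiplicity

/-! ### Fourier integrals for the multiplicities -/

/-- The character of `V^{k/2}` at `diag(e^{it/2}, e^{-it/2})`. -/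
noncomputable def spinCharacter (k : ℕ) (t : ℝ) : ℝ :=
  ∑ f : Fin (k + 1), Real.cos (t * ((k : ℝ) - 2 * (f : ℕ)) / 2)

/-- The weights are symmetric under `f ↦ k - f`, so the sines cancel. -/
lemma spinCharacter_eq_exp (k : ℕ) (t : ℝ) : (spinCharacter k t : ℂ) =
    ∑ f : Fin (k + 1), Complex.exp (((t * ((k : ℝ) - 2 * (f : ℕ)) / 2 : ℝ) : ℂ) * Complex.I) := by
  have h : ∑ f : Fin (k + 1), Real.sin (t * ((k : ℝ) - 2 * (f : ℕ)) / 2) = 0 := by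
    have h1 := Equiv.sum_comp (Fin.revPerm (n := k + 1))
      (fun f : Fin (k + 1) => Real.sin (t * ((k : ℝ) - 2 * (f : ℕ)) / 2))
    have h2 : ∀ f : Fin (k + 1), Real.sin (t * ((k : ℝ) - 2 * (Fin.revPerm f : Fin (k + 1)).val) / 2)
        = - Real.sin (t * ((k : ℝ) - 2 * (f : ℕ)) / 2) := by
      intro f
      rw [← Real.sin_neg, Fin.revPerm_apply, Fin.val_rev,
        show k + 1 - (f.val + 1) = k - f.val by omega, Nat.cast_sub (Nat.lt_succ_iff.1 f.2)]
      congr 1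
      ring
    simp only [h2, Finset.sum_neg_distrib] at h1
    linarith
  simp only [Complex.exp_mul_I, ← Complex.ofReal_cos, ← Complex.ofReal_sin, Finset.sum_add_distrib,
    ← Finset.sum_mul, ← Complex.ofReal_sum, h]
  simp [spinCharacter]

lemma spinCharacter_pow_mul_cos (k n : ℕ) (j : ℤ) (t : ℝ) :
    spinCharacter k t ^ n * Real.cos (j * t / 2) =
      ∑ f : Fin n → Fin (k + 1),
        Real.cos (t * (((∑ i, ((k : ℤ) - 2 * (f i : ℕ))) - j : ℤ) : ℝ) / 2) := by
  have h : ((spinCharacter k t ^ n : ℝ) : ℂ) * Complex.exp (((-(j * t / 2) : ℝ) : ℂ) * Complex.I) =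
      ∑ f : Fin n → Fin (k + 1), Complex.exp
        (((t * (((∑ i, ((k : ℤ) - 2 * (f i : ℕ))) - j : ℤ) : ℝ) / 2 : ℝ) : ℂ) * Complex.I) := by
    rw [Complex.ofReal_pow, spinCharacter_eq_exp, ← Fin.prod_const, Finset.prod_univ_sum,
      Fintype.piFinset_univ, Finset.sum_mul]
    refine Finset.sum_congr rfl fun f _ => ?_
    rw [← Complex.exp_sum, ← Complex.exp_add, ← Finset.sum_mul, ← add_mul]
    congr 2
    push_cast
    rw [← Finset.sum_div, ← Finset.mul_sum]
    ring
  have h2 := congrArg Complex.re h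
  rw [Complex.re_ofReal_mul, Complex.exp_ofReal_mul_I_re, Complex.re_sum, Real.cos_neg] at h2
  simpa only [Complex.exp_ofReal_mul_I_re] using h2

lemma integral_cos_int_mul (a : ℤ) :
    ∫ t in (-Real.pi)..Real.pi, Real.cos (t * a) = if a = 0 then 2 * Real.pi else 0 := by
  split_ifs with h
  · subst h
    simp
    ring
  · have ha : (a : ℝ) ≠ 0 := by exact_mod_cast h
    rw [intervalIntegral.integral_comp_mul_right _ ha, integral_cos]
    have h1 : Real.sin (Real.pi * a) = 0 := by rw [mul_comm]; exact Real.sin_int_mul_pi a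
    simp [h1]

lemma sum_weights_parity {k n : ℕ} (f : Fin n → Fin (k + 1)) :
    (2 : ℤ) ∣ (∑ i, ((k : ℤ) - 2 * (f i : ℕ))) - n * k := by
  refine ⟨-∑ i, ((f i : ℕ) : ℤ), ?_⟩
  rw [Finset.sum_sub_distrib, ← Finset.mul_sum]
  simp

lemma weightMult_eq_zero {k n : ℕ} {j : ℤ} (h : ¬ (2 : ℤ) ∣ j - n * k) : weightMult k n j = 0 := by
  rw [weightMult, Nat.card_eq_zero]
  left
  refine ⟨fun f => h ?_⟩
  have := sum_weights_parity f.1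
  rwa [f.2] at this

lemma weightMult_le (k n : ℕ) (j : ℤ) : weightMult k n j ≤ (k + 1) ^ n := by
  have := Nat.card_le_card_of_injective (Subtype.val :
    {f : Fin n → Fin (k + 1) // ∑ i, ((k : ℤ) - 2 * (f i : ℕ)) = j} → _) Subtype.val_injective
  simpa [weightMult] using this

/-- Orthogonality of cosines over one period. The parity hypothesis makes every frequency `(weight -
j)/2` an integer. -/
lemma weightMult_eq_integral {k n : ℕ} {j : ℤ} (h : (2 : ℤ) ∣ j - n * k) :
    (weightMult k n j : ℝ) * (2 * Real.pi) =
      ∫ t in (-Real.pi)..Real.pi, spinCharacter k t ^ n * Real.cos (j * t / 2) := by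
  simp only [spinCharacter_pow_mul_cos]
  rw [intervalIntegral.integral_finsetSum (fun f _ => Continuous.intervalIntegrable (by fun_prop) _ _)]
  have h1 : ∀ f : Fin n → Fin (k + 1), ∫ t in (-Real.pi)..Real.pi,
      Real.cos (t * (((∑ i, ((k : ℤ) - 2 * (f i : ℕ))) - j : ℤ) : ℝ) / 2) =
      if (∑ i, ((k : ℤ) - 2 * (f i : ℕ))) = j then 2 * Real.pi else 0 := by
    intro f
    obtain ⟨a, ha⟩ : (2 : ℤ) ∣ (∑ i, ((k : ℤ) - 2 * (f i : ℕ))) - j := by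
      have := dvd_sub (sum_weights_parity f) h
      rwa [sub_sub_sub_cancel_right] at this
    have h2 : ((∑ i, ((k : ℤ) - 2 * (f i : ℕ))) = j) ↔ a = 0 := by omega
    simp only [h2]
    rw [← integral_cos_int_mul, ha]
    congr 1
    funext t
    congr 1
    push_cast
    ring
  simp only [h1]
  rw [Finset.sum_ite, Finset.sum_const_zero, add_zero, Finset.sum_const, nsmul_eq_mul, weightMult,
    Nat.card_eq_fintype_card, Fintype.card_subtype]

lemma continuous_spinCharacter (k : ℕ) : Continuous (spinCharacter k) := by
  unfold spinCharacter
  fun_prop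

/-- The recurrence subtracts two cosine integrals, and the difference of cosines is `2 sin((j+1)t/2)
sin(t/2)`. -/
lemma isSpinMultiplicity_eq_integral {k n : ℕ} {d : ℕ → ℕ} (hd : IsSpinMultiplicity k n d) {j : ℕ}
    (h : (2 : ℤ) ∣ j - n * k) :
    (d j : ℝ) * Real.pi = ∫ t in (-Real.pi)..Real.pi,
      spinCharacter k t ^ n * (Real.sin ((j + 1) * t / 2) * Real.sin (t / 2)) := by
  have h1 := weightMult_eq_integral h
  have h2 := weightMult_eq_integral (j := j + 2) (k := k) (n := n) (by omega)
  have h3 := isSpinMultiplicity_recurrence hd j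
  rw [h3] at h1
  have hc := continuous_spinCharacter k
  have h4 : (d j : ℝ) * (2 * Real.pi) = ∫ t in (-Real.pi)..Real.pi,
      (spinCharacter k t ^ n * Real.cos (((j : ℤ) : ℝ) * t / 2) -
        spinCharacter k t ^ n * Real.cos (((j + 2 : ℤ) : ℝ) * t / 2)) := by
    rw [intervalIntegral.integral_sub (Continuous.intervalIntegrable (by fun_prop) _ _)
      (Continuous.intervalIntegrable (by fun_prop) _ _), ← h1, ← h2]
    push_cast
    ring
  have h5 : ∀ t, spinCharacter k t ^ n * Real.cos (((j : ℤ) : ℝ) * t / 2) -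
        spinCharacter k t ^ n * Real.cos (((j + 2 : ℤ) : ℝ) * t / 2) =
      2 * (spinCharacter k t ^ n * (Real.sin ((j + 1) * t / 2) * Real.sin (t / 2))) := by
    intro t
    have e1 : ((j : ℤ) : ℝ) * t / 2 = (j + 1) * t / 2 - t / 2 := by push_cast; ring
    have e2 : ((j + 2 : ℤ) : ℝ) * t / 2 = (j + 1) * t / 2 + t / 2 := by push_cast; ring
    rw [e1, e2, Real.cos_sub, Real.cos_add]
    ring
  simp only [h5, intervalIntegral.integral_const_mul] at h4
  linarith

lemma isSpinMultiplicity_eq_zero {k n : ℕ} {d : ℕ → ℕ} (hd : IsSpinMultiplicity k n d) {j : ℕ}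
    (h : ¬ (2 : ℤ) ∣ j - n * k) : d j = 0 := by
  have h1 := isSpinMultiplicity_recurrence hd j
  rw [weightMult_eq_zero h] at h1
  omega

lemma isSpinMultiplicity_exists_max {k n : ℕ} {d : ℕ → ℕ} (hd : IsSpinMultiplicity k n d) :
    ∃ j, ∀ i, d i ≤ d j := by
  have hb : BddAbove (Set.range d) := by
    refine ⟨(k + 1) ^ n, ?_⟩
    rintro _ ⟨j, rfl⟩
    have h1 := isSpinMultiplicity_recurrence hd j
    have h2 := weightMult_le k n j
    omega
  obtain ⟨j, hj⟩ := Nat.sSup_mem (Set.range_nonempty d) hb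
  exact ⟨j, fun i => hj ▸ le_csSup hb ⟨i, rfl⟩⟩

/-! ### Gaussian integrals and Gaussian behaviour of the character -/

/-- A Gaussian sine integral. -/
lemma integral_mul_exp_neg_mul_sq_mul_sin {b : ℝ} (hb : 0 < b) (y : ℝ) :
    ∫ u : ℝ, u * Real.exp (-b * u ^ 2) * Real.sin (y * u) =
      y / (2 * b) * (Real.sqrt (Real.pi / b) * Real.exp (-(y ^ 2) / (4 * b))) := by
  have hcos : ∫ u : ℝ, Real.cos (y * u) * Real.exp (-b * u ^ 2) =
      Real.sqrt (Real.pi / b) * Real.exp (-(y ^ 2) / (4 * b)) := by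
    have h := fourierIntegral_gaussian (b := (b : ℂ)) (by simpa using hb) (y : ℂ)
    have h1 : ∀ u : ℝ, Complex.exp (Complex.I * y * u) * Complex.exp (-b * u ^ 2) =
        Complex.exp (((y * u : ℝ) : ℂ) * Complex.I) * ((Real.exp (-b * u ^ 2) : ℝ) : ℂ) := by
      intro u
      push_cast
      congr 2
      ring
    simp only [h1] at h
    have h2 := congrArg Complex.re h
    have hint : MeasureTheory.Integrable (fun u : ℝ =>
        Complex.exp (((y * u : ℝ) : ℂ) * Complex.I) * ((Real.exp (-b * u ^ 2) : ℝ) : ℂ)) := by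
      refine (integrable_exp_neg_mul_sq hb).ofReal.bdd_mul (c := 1)
        (Continuous.aestronglyMeasurable (by fun_prop)) (Eventually.of_forall fun u => ?_)
      rw [Complex.norm_exp_ofReal_mul_I]
    rw [← Complex.reCLM_apply, ← ContinuousLinearMap.integral_comp_comm _ hint] at h2
    simp only [Complex.reCLM_apply, Complex.re_mul_ofReal, Complex.exp_ofReal_mul_I_re] at h2
    rw [h2, Real.sqrt_eq_rpow]
    have h3 : ((Real.pi : ℂ) / b) ^ (1 / 2 : ℂ) = (((Real.pi / b) ^ (1 / 2 : ℝ) : ℝ) : ℂ) := by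
      rw [Complex.ofReal_cpow (by positivity)]
      push_cast
      rfl
    have h4 : Complex.exp (-(y : ℂ) ^ 2 / (4 * b)) = ((Real.exp (-(y ^ 2) / (4 * b)) : ℝ) : ℂ) := by
      push_cast
      rfl
    rw [h3, h4, ← Complex.ofReal_mul, Complex.ofReal_re]
  have hbd : ∀ {g : ℝ → ℝ}, Continuous g → (∀ u, |g u| ≤ 1) → ∀ {F : ℝ → ℝ},
      MeasureTheory.Integrable F → MeasureTheory.Integrable fun u => g u * F u :=
    fun hg h1 _ hF => hF.bdd_mul (c := 1) hg.aestronglyMeasurable (Eventually.of_forall h1)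
  -- Integration by parts with `-e^{-bu²}/(2b)`, a primitive of `u e^{-bu²}`, reduces the sine
  -- integral to the cosine one.
  have hparts := MeasureTheory.integral_mul_deriv_eq_deriv_mul_of_integrable
    (u := fun u : ℝ => Real.sin (y * u)) (u' := fun u : ℝ => Real.cos (y * u) * y)
    (v := fun u : ℝ => -(1 / (2 * b)) * Real.exp (-b * u ^ 2))
    (v' := fun u : ℝ => u * Real.exp (-b * u ^ 2))
    (fun x _ => by
      have := ((hasDerivAt_id x).const_mul y).sin
      simpa using this)
    (fun x _ => by
      have := (((hasDerivAt_pow 2 x).const_mul (-b)).exp).const_mul (-(1 / (2 * b)))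
      convert! this using 1
      field_simp
      simp [mul_comm])
    (hbd (by fun_prop) (fun u => Real.abs_sin_le_one _) (integrable_mul_exp_neg_mul_sq hb))
    (by
      have := (hbd (g := fun u => Real.cos (y * u)) (by fun_prop) (fun u => Real.abs_cos_le_one _)
        (integrable_exp_neg_mul_sq hb)).const_mul (y * -(1 / (2 * b)))
      refine this.congr (Eventually.of_forall fun u => ?_)
      simp only [Pi.mul_apply]
      ring)
    (hbd (by fun_prop) (fun u => Real.abs_sin_le_one _)
      ((integrable_exp_neg_mul_sq hb).const_mul _))
  calc ∫ u : ℝ, u * Real.exp (-b * u ^ 2) * Real.sin (y * u)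
      = ∫ u : ℝ, Real.sin (y * u) * (u * Real.exp (-b * u ^ 2)) := by
        congr 1; funext u; ring
    _ = -∫ u : ℝ, Real.cos (y * u) * y * (-(1 / (2 * b)) * Real.exp (-b * u ^ 2)) := hparts
    _ = y / (2 * b) * ∫ u : ℝ, Real.cos (y * u) * Real.exp (-b * u ^ 2) := by
        rw [← MeasureTheory.integral_const_mul, ← MeasureTheory.integral_neg]
        congr 1; funext u; ring
    _ = _ := by rw [hcos]

/-- The variance of a uniformly distributed weight of `V^{k/2}`, in the normalisation of spins. -/
noncomputable def spinVariance (k : ℕ) : ℝ := k * (k + 2) / 12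

lemma spinVariance_pos {k : ℕ} (hk : 1 ≤ k) : 0 < spinVariance k := by
  have : (0 : ℝ) < k := by exact_mod_cast hk
  unfold spinVariance
  positivity

lemma sum_sq_weights (k : ℕ) : ∑ f : Fin (k + 1), (((k : ℝ) - 2 * (f : ℕ)) / 2) ^ 2 =
    (k + 1) * spinVariance k := by
  have h1 : ∀ n : ℕ, ∑ i ∈ Finset.range n, (i : ℝ) = n * (n - 1) / 2 := by
    intro n
    induction n with
    | zero => simp
    | succ n ih => rw [Finset.sum_range_succ, ih]; push_cast; ring
  have h2 : ∀ n : ℕ, ∑ i ∈ Finset.range n, (i : ℝ) ^ 2 = n * (n - 1) * (2 * n - 1) / 6 := by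
    intro n
    induction n with
    | zero => simp
    | succ n ih => rw [Finset.sum_range_succ, ih]; push_cast; ring
  rw [Fin.sum_univ_eq_sum_range (fun i => (((k : ℝ) - 2 * (i : ℕ)) / 2) ^ 2) (k + 1)]
  have h3 : ∀ i : ℕ, (((k : ℝ) - 2 * i) / 2) ^ 2 = (k : ℝ) ^ 2 / 4 - k * i + (i : ℝ) ^ 2 := by
    intro i; ring
  simp only [h3, Finset.sum_add_distrib, Finset.sum_sub_distrib, ← Finset.mul_sum, h1, h2,
    Finset.sum_const, Finset.card_range, nsmul_eq_mul]
  unfold spinVariance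
  push_cast
  ring

/-- Two adjacent exponentials have phases differing by `t` and add up to modulus `2 cos(t/2)`; the
other `k - 1` are bounded by `1`. The resulting Gaussian bound holds on the whole period, so its
`n`-th power is an integrable majorant after rescaling. -/
lemma abs_spinCharacter_le {k : ℕ} (hk : 1 ≤ k) {t : ℝ} (ht : |t| ≤ Real.pi) :
    |spinCharacter k t / (k + 1)| ≤ Real.exp (-(1 / (Real.pi ^ 2 * (k + 1))) * t ^ 2) := by
  obtain ⟨m, rfl⟩ : ∃ m, k = m + 1 := ⟨k - 1, by omega⟩
  have hcos : 0 ≤ Real.cos (t / 2) := by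
    apply Real.cos_nonneg_of_mem_Icc
    rw [abs_le] at ht
    constructor <;> linarith
  have hcos2 : Real.cos (t / 2) ≤ 1 - 2 / Real.pi ^ 2 * (t / 2) ^ 2 := by
    apply Real.cos_le_one_sub_mul_cos_sq
    rw [abs_div, abs_two]
    have := abs_nonneg t
    linarith
  have h1 : |spinCharacter (m + 1) t| ≤ m + 2 * Real.cos (t / 2) := by
    rw [← Real.norm_eq_abs, ← Complex.norm_real, spinCharacter_eq_exp, Fin.sum_univ_castSucc,
      Fin.sum_univ_castSucc, add_assoc]
    refine (norm_add_le _ _).trans (add_le_add ?_ ?_)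
    · refine (norm_sum_le _ _).trans ?_
      simp only [Complex.norm_exp_ofReal_mul_I]
      simp
    · set α : ℝ := t * (((m + 1 : ℕ) : ℝ) - 2 * m) / 2 - t / 2 with hα
      have e1 : t * (((m + 1 : ℕ) : ℝ) - 2 * ((Fin.last m).castSucc : Fin (m + 2)).val) / 2
          = α + t / 2 := by
        simp [hα]
      have e2 : t * (((m + 1 : ℕ) : ℝ) - 2 * (Fin.last (m + 1)).val) / 2 = α - t / 2 := by
        simp [hα]; ring
      rw [e1, e2]
      have e3 : Complex.exp (((α + t / 2 : ℝ) : ℂ) * Complex.I) +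
          Complex.exp (((α - t / 2 : ℝ) : ℂ) * Complex.I) =
          Complex.exp ((α : ℂ) * Complex.I) * ((2 * Real.cos (t / 2) : ℝ) : ℂ) := by
        push_cast
        rw [Complex.two_cos, mul_add, ← Complex.exp_add, ← Complex.exp_add]
        congr 2 <;> ring
      rw [e3, norm_mul, Complex.norm_exp_ofReal_mul_I, one_mul, Complex.norm_real,
        Real.norm_of_nonneg (by positivity)]
  have hpi := Real.pi_pos
  rw [abs_div, abs_of_pos (by positivity : (0 : ℝ) < ((m + 1 : ℕ) : ℝ) + 1)]
  -- The rate comes from `2 cos(t/2) ≤ 2 - t²/π²`, divided by `k + 1`.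
  refine le_trans ?_ (Real.add_one_le_exp _)
  rw [div_le_iff₀ (by positivity)]
  refine h1.trans ?_
  have e4 : (-(1 / (Real.pi ^ 2 * (((m + 1 : ℕ) : ℝ) + 1))) * t ^ 2 + 1) * (((m + 1 : ℕ) : ℝ) + 1)
      = (m + 2) - t ^ 2 / Real.pi ^ 2 := by
    push_cast
    field_simp
    ring
  have e5 : 2 / Real.pi ^ 2 * (t / 2) ^ 2 = t ^ 2 / Real.pi ^ 2 / 2 := by ring
  rw [e4]
  linarith

lemma tendsto_sqrt_mul_sin (c : ℝ) :
    Tendsto (fun n : ℕ => Real.sqrt n * Real.sin (c / Real.sqrt n)) atTop (𝓝 c) := by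
  have h0 : Tendsto (fun n : ℕ => c / Real.sqrt n) atTop (𝓝 0) :=
    (tendsto_const_nhds).div_atTop (Real.tendsto_sqrt_atTop.comp tendsto_natCast_atTop_atTop)
  have h1 : Tendsto (fun n : ℕ => c * Real.sinc (c / Real.sqrt n)) atTop (𝓝 (c * 1)) := by
    refine Tendsto.const_mul c ?_
    have := Real.continuous_sinc.tendsto 0
    rw [Real.sinc_zero] at this
    exact this.comp h0
  rw [mul_one] at h1
  refine h1.congr' ?_
  filter_upwards [eventually_gt_atTop 0] with n hn
  have hs : Real.sqrt n ≠ 0 := (Real.sqrt_pos.2 (by exact_mod_cast hn)).ne'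
  rcases eq_or_ne c 0 with rfl | hc
  · simp
  · rw [Real.sinc_of_ne_zero (div_ne_zero hc hs)]
    field_simp

/-- The central limit theorem for characteristic functions: `χ/(k+1)` is that of a uniform weight,
whose second-order term at `0` is half the variance. -/
lemma tendsto_spinCharacter_pow (k : ℕ) (u : ℝ) :
    Tendsto (fun n : ℕ => (spinCharacter k (u / Real.sqrt n) / (k + 1)) ^ n) atTop
      (𝓝 (Real.exp (-(spinVariance k / 2) * u ^ 2))) := by
  have hcos : ∀ v : ℝ, Tendsto (fun n : ℕ => n * (Real.cos (v / Real.sqrt n) - 1)) atTop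
      (𝓝 (-(v ^ 2) / 2)) := by
    intro v
    have h := ((tendsto_sqrt_mul_sin (v / 2)).pow 2).const_mul (-2)
    rw [show -2 * (v / 2) ^ 2 = -(v ^ 2) / 2 by ring] at h
    refine h.congr fun n => ?_
    have h1 : Real.cos (v / Real.sqrt n) = 1 - 2 * Real.sin (v / 2 / Real.sqrt n) ^ 2 := by
      rw [show v / Real.sqrt n = 2 * (v / 2 / Real.sqrt n) by ring, Real.cos_two_mul,
        Real.cos_sq']
      ring
    rw [h1, mul_pow, Real.sq_sqrt (Nat.cast_nonneg n)]
    ring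
  have hk : (k : ℝ) + 1 ≠ 0 := by positivity
  have h2 : Tendsto (fun n : ℕ => n * (spinCharacter k (u / Real.sqrt n) / (k + 1) - 1)) atTop
      (𝓝 (-(spinVariance k / 2) * u ^ 2)) := by
    have h3 := (tendsto_finsetSum (Finset.univ : Finset (Fin (k + 1)))
      (fun f _ => hcos (u * ((k : ℝ) - 2 * (f : ℕ)) / 2))).div_const ((k : ℝ) + 1)
    have e : (∑ f : Fin (k + 1), -((u * ((k : ℝ) - 2 * (f : ℕ)) / 2) ^ 2) / 2) / ((k : ℝ) + 1) =
        -(spinVariance k / 2) * u ^ 2 := by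
      have : ∀ f : Fin (k + 1), -((u * ((k : ℝ) - 2 * (f : ℕ)) / 2) ^ 2) / 2 =
        (-(u ^ 2) / 2) * (((k : ℝ) - 2 * (f : ℕ)) / 2) ^ 2 := fun f => by ring
      simp only [this, ← Finset.mul_sum, sum_sq_weights]
      field_simp
    rw [e] at h3
    refine h3.congr fun n => ?_
    rw [← Finset.mul_sum, Finset.sum_sub_distrib, spinCharacter]
    simp only [Finset.sum_const, Finset.card_univ, Fintype.card_fin, nsmul_eq_mul, mul_one]
    have : ∀ f : Fin (k + 1), u * ((k : ℝ) - 2 * (f : ℕ)) / 2 / Real.sqrt n =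
      u / Real.sqrt n * ((k : ℝ) - 2 * (f : ℕ)) / 2 := fun f => by ring
    simp only [this]
    push_cast
    field_simp
  refine (Real.tendsto_one_add_pow_exp_of_tendsto h2).congr fun n => ?_
  congr 1
  ring

/-! ### Uniform local limit theorem -/

/-- The rescaled integrand of the Fourier integral of the multiplicities. -/
noncomputable def rescaledKernel (k n : ℕ) : ℝ → ℝ :=
  (Set.Ioc (-(Real.pi * Real.sqrt n)) (Real.pi * Real.sqrt n)).indicator fun u =>
    (spinCharacter k (u / Real.sqrt n) / (k + 1)) ^ n * (Real.sqrt n * Real.sin (u / 2 / Real.sqrt n))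

/-- The pointwise limit of `rescaledKernel k n`. -/
noncomputable def limitKernel (k : ℕ) (u : ℝ) : ℝ :=
  Real.exp (-(spinVariance k / 2) * u ^ 2) * (u / 2)

lemma tendsto_rescaledKernel (k : ℕ) (u : ℝ) :
    Tendsto (fun n => rescaledKernel k n u) atTop (𝓝 (limitKernel k u)) := by
  have h := (tendsto_spinCharacter_pow k u).mul (tendsto_sqrt_mul_sin (u / 2))
  refine h.congr' ?_
  have h1 : Tendsto (fun n : ℕ => Real.pi * Real.sqrt n) atTop atTop :=
    (Real.tendsto_sqrt_atTop.comp tendsto_natCast_atTop_atTop).const_mul_atTop Real.pi_pos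
  filter_upwards [h1.eventually_gt_atTop |u|] with n hn
  rw [abs_lt] at hn
  have hu : u ∈ Set.Ioc (-(Real.pi * Real.sqrt n)) (Real.pi * Real.sqrt n) := ⟨hn.1, hn.2.le⟩
  rw [rescaledKernel, Set.indicator_of_mem hu]

lemma abs_rescaledKernel_le {k : ℕ} (hk : 1 ≤ k) (n : ℕ) (u : ℝ) :
    |rescaledKernel k n u| ≤
      |u * Real.exp (-(1 / (Real.pi ^ 2 * (k + 1))) * u ^ 2)| := by
  rw [rescaledKernel]
  by_cases hu : u ∈ Set.Ioc (-(Real.pi * Real.sqrt n)) (Real.pi * Real.sqrt n)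
  · rw [Set.indicator_of_mem hu]
    have hn : 0 < Real.sqrt n := by
      have := hu.1.trans_le hu.2
      have hp := Real.pi_pos
      by_contra hcon
      have h0 : Real.sqrt n = 0 := le_antisymm (not_lt.1 hcon) (Real.sqrt_nonneg _)
      simp [h0] at this
    have ht : |u / Real.sqrt n| ≤ Real.pi := by
      rw [abs_div, abs_of_pos hn, div_le_iff₀ hn, abs_le]
      exact ⟨hu.1.le, hu.2⟩
    rw [abs_mul, abs_mul u, mul_comm |u|, Real.abs_exp]
    refine mul_le_mul ?_ ?_ (abs_nonneg _) (Real.exp_pos _).le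
    · rw [abs_pow]
      refine (pow_le_pow_left₀ (abs_nonneg _) (abs_spinCharacter_le hk ht) n).trans_eq ?_
      rw [← Real.exp_nat_mul, div_pow, Real.sq_sqrt (Nat.cast_nonneg n)]
      have : (n : ℝ) ≠ 0 := fun h => by simp [h] at hn
      congr 1
      field_simp
    · rw [abs_mul, abs_of_pos hn]
      calc Real.sqrt n * |Real.sin (u / 2 / Real.sqrt n)|
          ≤ Real.sqrt n * |u / 2 / Real.sqrt n| :=
            mul_le_mul_of_nonneg_left Real.abs_sin_le_abs hn.le
        _ = |u| / 2 := by
            rw [abs_div, abs_div, abs_two, abs_of_pos hn]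
            field_simp
        _ ≤ |u| := by linarith [abs_nonneg u]
  · rw [Set.indicator_of_notMem hu, abs_zero]
    exact abs_nonneg _

lemma measurable_rescaledKernel (k n : ℕ) : Measurable (rescaledKernel k n) := by
  have := continuous_spinCharacter k
  refine Measurable.indicator ?_ measurableSet_Ioc
  exact Continuous.measurable (by fun_prop)

lemma integrable_rescaledKernel {k : ℕ} (hk : 1 ≤ k) (n : ℕ) :
    MeasureTheory.Integrable (rescaledKernel k n) :=
  (integrable_mul_exp_neg_mul_sq (b := 1 / (Real.pi ^ 2 * (k + 1)))
    (by have := Real.pi_pos; positivity)).mono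
    (measurable_rescaledKernel k n).aestronglyMeasurable
    (Eventually.of_forall fun u => abs_rescaledKernel_le hk n u)

lemma integrable_limitKernel {k : ℕ} (hk : 1 ≤ k) : MeasureTheory.Integrable (limitKernel k) := by
  refine ((integrable_mul_exp_neg_mul_sq (half_pos (spinVariance_pos hk))).const_mul (1 / 2)).congr
    (Eventually.of_forall fun u => ?_)
  simp only [limitKernel]
  ring

/-- Dominated convergence in L¹. The kernel omits the factor `sin((j+1)u/(2√n))`, which is bounded
by `1`, so this distance controls all `j` at once. -/
lemma tendsto_integral_abs_kernel_sub {k : ℕ} (hk : 1 ≤ k) :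
    Tendsto (fun n => ∫ u, |rescaledKernel k n u - limitKernel k u|) atTop (𝓝 0) := by
  have h := MeasureTheory.tendsto_integral_of_dominated_convergence
    (μ := MeasureTheory.volume) (F := fun n u => |rescaledKernel k n u - limitKernel k u|)
    (f := fun _ => 0)
    (fun u => |u * Real.exp (-(1 / (Real.pi ^ 2 * (k + 1))) * u ^ 2)| + |limitKernel k u|)
    (fun n => ((integrable_rescaledKernel hk n).sub
      (integrable_limitKernel hk)).abs.aestronglyMeasurable)
    ((integrable_mul_exp_neg_mul_sq
      (by have := Real.pi_pos; positivity)).abs.add (integrable_limitKernel hk).abs)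
    (fun n => Eventually.of_forall fun u => by
      rw [Real.norm_eq_abs, abs_abs]
      exact (abs_sub _ _).trans (add_le_add_left (abs_rescaledKernel_le hk n u) _))
    (Eventually.of_forall fun u => by
      have := ((tendsto_rescaledKernel k u).sub_const (limitKernel k u)).abs
      simpa using this)
  simpa using h

/-- Substituting `t = u/√n` yields one factor `√n`; the one built into the kernel beside the sine
yields the other, hence the `n`. -/
lemma isSpinMultiplicity_rescaled {k n : ℕ} {d : ℕ → ℕ} (hd : IsSpinMultiplicity k n d) {j : ℕ}
    (hn : 0 < n) (h : (2 : ℤ) ∣ j - n * k) :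
    (d j : ℝ) * n / (k + 1) ^ n * Real.pi =
      ∫ u, rescaledKernel k n u * Real.sin ((j + 1) / (2 * Real.sqrt n) * u) := by
  have hs : 0 < Real.sqrt n := Real.sqrt_pos.2 (by exact_mod_cast hn)
  have hp := Real.pi_pos
  have h1 : ∫ u, rescaledKernel k n u * Real.sin ((j + 1) / (2 * Real.sqrt n) * u) =
      ∫ u in (-(Real.pi * Real.sqrt n))..(Real.pi * Real.sqrt n),
        (spinCharacter k (u / Real.sqrt n) / (k + 1)) ^ n *
          (Real.sqrt n * Real.sin (u / 2 / Real.sqrt n)) *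
          Real.sin ((j + 1) / (2 * Real.sqrt n) * u) := by
    rw [intervalIntegral.integral_of_le (by linarith [mul_pos hp hs]),
      ← MeasureTheory.integral_indicator measurableSet_Ioc]
    congr 1
    funext u
    rw [rescaledKernel]
    by_cases hu : u ∈ Set.Ioc (-(Real.pi * Real.sqrt n)) (Real.pi * Real.sqrt n)
    · simp only [Set.indicator_of_mem hu]
    · simp only [Set.indicator_of_notMem hu, zero_mul]
  have h2 := intervalIntegral.integral_comp_div (a := -(Real.pi * Real.sqrt n))
    (b := Real.pi * Real.sqrt n) (fun t => spinCharacter k t ^ n *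
      (Real.sin ((j + 1) * t / 2) * Real.sin (t / 2))) hs.ne'
  rw [neg_div, mul_div_cancel_right₀ _ hs.ne', ← isSpinMultiplicity_eq_integral hd h,
    smul_eq_mul] at h2
  have h3 : ∀ u : ℝ, (spinCharacter k (u / Real.sqrt n) / (k + 1)) ^ n *
          (Real.sqrt n * Real.sin (u / 2 / Real.sqrt n)) *
          Real.sin ((j + 1) / (2 * Real.sqrt n) * u) =
      Real.sqrt n / (k + 1) ^ n * (spinCharacter k (u / Real.sqrt n) ^ n *
      (Real.sin ((j + 1) * (u / Real.sqrt n) / 2) * Real.sin (u / Real.sqrt n / 2))) := by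
    intro u
    rw [div_pow, show u / 2 / Real.sqrt n = u / Real.sqrt n / 2 by ring,
      show (j + 1) / (2 * Real.sqrt n) * u = (j + 1) * (u / Real.sqrt n) / 2 by field_simp]
    ring
  rw [h1]
  simp only [h3]
  rw [intervalIntegral.integral_const_mul, h2]
  have h4 : (n : ℝ) = Real.sqrt n * Real.sqrt n := (Real.mul_self_sqrt (Nat.cast_nonneg n)).symm
  rw [show (d j : ℝ) * n = d j * (Real.sqrt n * Real.sqrt n) by rw [← h4]]
  ring

/-- The constant in front of `(k + 1) ^ n / n` in the maximal multiplicity. -/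
noncomputable def maxMultConst (k : ℕ) : ℝ :=
  1 / (spinVariance k * Real.sqrt (2 * Real.pi * Real.exp 1))

/-- The factor `e^{1/2}` is moved into the profile so that its maximum is `1`; this is the source of
`e` in `maxMultConst`. -/
lemma integral_limitKernel_mul_sin {k : ℕ} (hk : 1 ≤ k) (x : ℝ) :
    ∫ u, limitKernel k u * Real.sin (Real.sqrt (spinVariance k) * x * u) =
      maxMultConst k * (x * Real.exp ((1 - x ^ 2) / 2)) * Real.pi := by
  have hv := spinVariance_pos hk
  have h := integral_mul_exp_neg_mul_sq_mul_sin (half_pos hv) (Real.sqrt (spinVariance k) * x)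
  have h1 : ∀ u, limitKernel k u * Real.sin (Real.sqrt (spinVariance k) * x * u) =
      1 / 2 * (u * Real.exp (-(spinVariance k / 2) * u ^ 2) *
        Real.sin (Real.sqrt (spinVariance k) * x * u)) := by
    intro u
    simp only [limitKernel]
    ring
  simp only [h1]
  rw [MeasureTheory.integral_const_mul, h, maxMultConst]
  have hp := Real.pi_pos
  set v := spinVariance k with hvdef
  have hsv : Real.sqrt v ^ 2 = v := Real.sq_sqrt hv.le
  have hsv0 : 0 < Real.sqrt v := Real.sqrt_pos.2 hv
  have e1 : Real.exp (-(Real.sqrt v * x) ^ 2 / (4 * (v / 2))) = Real.exp (-(x ^ 2) / 2) := by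
    congr 1
    rw [mul_pow, hsv]
    field_simp
    ring
  have e2 : Real.exp ((1 - x ^ 2) / 2) = Real.exp (1 / 2) * Real.exp (-(x ^ 2) / 2) := by
    rw [← Real.exp_add]; congr 1; ring
  have e3 : Real.sqrt (2 * Real.pi * Real.exp 1) = Real.sqrt (2 * Real.pi) * Real.exp (1 / 2) := by
    rw [Real.sqrt_mul (by positivity), ← Real.exp_half]
  have e4 : Real.sqrt (Real.pi / (v / 2)) = Real.sqrt (2 * Real.pi) / Real.sqrt v := by
    rw [← Real.sqrt_div (by positivity)]
    congr 1
    field_simp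
  have e5 : Real.sqrt (2 * Real.pi) ^ 2 = 2 * Real.pi := Real.sq_sqrt (by positivity)
  have e6 : 0 < Real.sqrt (2 * Real.pi) := Real.sqrt_pos.2 (by positivity)
  rw [e1, e2, e3, e4]
  field_simp
  rw [e5]
  ring

/-- The uniform local limit theorem for the multiplicities. -/
lemma exists_tendsto_zero_multiplicity_error {k : ℕ} (hk : 1 ≤ k) :
    ∃ E : ℕ → ℝ, Tendsto E atTop (𝓝 0) ∧ ∀ n, 0 < n → ∀ d, IsSpinMultiplicity k n d →
      ∀ j : ℕ, (2 : ℤ) ∣ j - n * k → ∀ x : ℝ,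
        x = (j + 1) / (2 * Real.sqrt (spinVariance k) * Real.sqrt n) →
        |(d j : ℝ) * n / (k + 1) ^ n - maxMultConst k * (x * Real.exp ((1 - x ^ 2) / 2))| ≤ E n := by
  have hp := Real.pi_pos
  refine ⟨fun n => (∫ u, |rescaledKernel k n u - limitKernel k u|) / Real.pi, ?_, ?_⟩
  · simpa using (tendsto_integral_abs_kernel_sub hk).div_const Real.pi
  intro n hn d hd j hj x hx
  have hs : 0 < Real.sqrt n := Real.sqrt_pos.2 (by exact_mod_cast hn)
  have hv : 0 < Real.sqrt (spinVariance k) := Real.sqrt_pos.2 (spinVariance_pos hk)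
  have hy : Real.sqrt (spinVariance k) * x = (j + 1) / (2 * Real.sqrt n) := by
    rw [hx]; field_simp
  have h1 := isSpinMultiplicity_rescaled hd hn hj
  have h2 := integral_limitKernel_mul_sin hk x
  rw [hy] at h2
  have hb : ∀ {F : ℝ → ℝ}, MeasureTheory.Integrable F → MeasureTheory.Integrable
      fun u => F u * Real.sin ((j + 1) / (2 * Real.sqrt n) * u) := fun hF =>
    hF.mul_bdd (c := 1) (Continuous.aestronglyMeasurable (by fun_prop))
      (Eventually.of_forall fun u => Real.abs_sin_le_one _)
  rw [le_div_iff₀ hp]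
  conv_lhs => rw [← abs_of_pos hp]
  rw [← abs_mul, sub_mul, h1, ← h2,
    ← MeasureTheory.integral_sub (hb (integrable_rescaledKernel hk n))
      (hb (integrable_limitKernel hk))]
  refine (MeasureTheory.abs_integral_le_integral_abs).trans ?_
  refine MeasureTheory.integral_mono
    ((hb (integrable_rescaledKernel hk n)).sub (hb (integrable_limitKernel hk))).abs
    ((integrable_rescaledKernel hk n).sub (integrable_limitKernel hk)).abs fun u => ?_
  simp only
  rw [← sub_mul, abs_mul]
  exact mul_le_of_le_one_right (abs_nonneg _) (Real.abs_sin_le_one _)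

/-! ### Location and size of the maximum -/

lemma maxMultConst_pos {k : ℕ} (hk : 1 ≤ k) : 0 < maxMultConst k := by
  have := spinVariance_pos hk
  have := Real.pi_pos
  unfold maxMultConst
  positivity

/-- From `x ≤ e^{x-1}`, by completing the square. The bound gives both the maximum `1` and its
stability, with no sign condition on `x`. -/
lemma mul_exp_le_exp_neg_sq (x : ℝ) :
    x * Real.exp ((1 - x ^ 2) / 2) ≤ Real.exp (-((x - 1) ^ 2 / 2)) := by
  have h : x ≤ Real.exp (x - 1) := by linarith [Real.add_one_le_exp (x - 1)]
  calc x * Real.exp ((1 - x ^ 2) / 2) ≤ Real.exp (x - 1) * Real.exp ((1 - x ^ 2) / 2) := by gcongr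
    _ = _ := by rw [← Real.exp_add]; congr 1; ring

lemma mul_exp_le_one (x : ℝ) : x * Real.exp ((1 - x ^ 2) / 2) ≤ 1 :=
  (mul_exp_le_exp_neg_sq x).trans (Real.exp_le_one_iff.2 (by nlinarith [sq_nonneg (x - 1)]))

/-- `x e^{(1 - x²)/2}` is close to its maximum only near `x = 1`. -/
lemma tendsto_one_of_mul_exp {x : ℕ → ℝ}
    (h : Tendsto (fun n => x n * Real.exp ((1 - x n ^ 2) / 2)) atTop (𝓝 1)) :
    Tendsto x atTop (𝓝 1) := by
  have h1 : Tendsto (fun n => Real.exp (-((x n - 1) ^ 2 / 2))) atTop (𝓝 1) :=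
    tendsto_of_tendsto_of_tendsto_of_le_of_le h tendsto_const_nhds
      (fun n => mul_exp_le_exp_neg_sq _)
      (fun n => Real.exp_le_one_iff.2 (by nlinarith [sq_nonneg (x n - 1)]))
  have h2 := ((h1.log one_ne_zero).const_mul (-2))
  simp only [Real.log_exp, Real.log_one, mul_zero] at h2
  have h3 := h2.sqrt
  have h4 : ∀ n, Real.sqrt (-2 * -((x n - 1) ^ 2 / 2)) = |x n - 1| := fun n => by
    rw [← Real.sqrt_sq_eq_abs]; congr 1; ring
  simp only [h4, Real.sqrt_zero] at h3
  have h5 := (tendsto_zero_iff_abs_tendsto_zero _).2 h3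
  simpa using h5.add_const 1

/-- Spins of the right parity close to `2 s √n`. -/
lemma exists_parity_tendsto (k : ℕ) {s : ℝ} (hs : 0 < s) : ∃ j : ℕ → ℕ,
    (∀ n : ℕ, (2 : ℤ) ∣ j n - n * k) ∧
    Tendsto (fun n : ℕ => (j n + 1 : ℝ) / (2 * s * Real.sqrt n)) atTop (𝓝 1) := by
  have hsq : Tendsto (fun n : ℕ => s * Real.sqrt n) atTop atTop :=
    (Real.tendsto_sqrt_atTop.comp tendsto_natCast_atTop_atTop).const_mul_atTop hs
  -- An even number near `2s√n`, corrected by the parity of `nk`.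
  refine ⟨fun n => 2 * ⌊s * Real.sqrt n⌋₊ + n * k % 2, fun n => ?_, ?_⟩
  · have : (n : ℤ) * k = ((n * k : ℕ) : ℤ) := by push_cast; ring
    rw [this]
    push_cast [-Nat.cast_mul]
    omega
  · have h1 := (tendsto_nat_floor_div_atTop (R := ℝ)).comp hsq
    have h2 : Tendsto (fun n : ℕ => (((n * k % 2 : ℕ) : ℝ) + 1) / (2 * s * Real.sqrt n)) atTop
        (𝓝 0) := by
      refine squeeze_zero' (Eventually.of_forall fun n => by positivity) ?_
        ((tendsto_const_nhds (x := (1 : ℝ))).div_atTop hsq)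
      filter_upwards [eventually_gt_atTop 0] with n hn
      have : 0 < Real.sqrt n := Real.sqrt_pos.2 (by exact_mod_cast hn)
      have h3 : ((n * k % 2 : ℕ) : ℝ) ≤ 1 := by exact_mod_cast (by omega : n * k % 2 ≤ 1)
      rw [div_le_div_iff₀ (by positivity) (by positivity)]
      have : 0 < s * Real.sqrt n := by positivity
      nlinarith
    have h3 := h1.add h2
    rw [add_zero] at h3
    refine h3.congr' ?_
    filter_upwards [eventually_gt_atTop 0] with n hn
    have : 0 < Real.sqrt n := Real.sqrt_pos.2 (by exact_mod_cast hn)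
    simp only [Function.comp_apply]
    push_cast
    field_simp
    ring

section

variable {k : ℕ} {d : ℕ → ℕ → ℕ} {J : ℕ → ℕ}

/-- The maximum is at least the value at a spin `j n` of the right parity with `y n → 1`, and at
most `maxMultConst k + E n`. Both bounds tend to the same limit, which in turn forces the profile at
the maximiser to tend to `1`. -/
lemma tendsto_max_multiplicity (hk : 1 ≤ k) (hd : ∀ n, IsSpinMultiplicity k n (d n))
    (hJ : ∀ n i, d n i ≤ d n (J n)) :
    Tendsto (fun n => (d n (J n) : ℝ) * n / (k + 1) ^ n) atTop (𝓝 (maxMultConst k)) ∧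
    Tendsto (fun n => (J n + 1 : ℝ) / (2 * Real.sqrt (spinVariance k) * Real.sqrt n)) atTop
      (𝓝 1) := by
  have hC := maxMultConst_pos hk
  have hv : 0 < Real.sqrt (spinVariance k) := Real.sqrt_pos.2 (spinVariance_pos hk)
  obtain ⟨E, hE0, hE⟩ := exists_tendsto_zero_multiplicity_error hk
  obtain ⟨j, hj, hj1⟩ := exists_parity_tendsto k hv
  set a : ℕ → ℝ := fun n => (d n (J n) : ℝ) * n / (k + 1) ^ n with ha
  set x : ℕ → ℝ := fun n => (J n + 1 : ℝ) / (2 * Real.sqrt (spinVariance k) * Real.sqrt n) with hx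
  set y : ℕ → ℝ := fun n => (j n + 1 : ℝ) / (2 * Real.sqrt (spinVariance k) * Real.sqrt n) with hy
  have hlow : Tendsto (fun n => maxMultConst k * (y n * Real.exp ((1 - y n ^ 2) / 2)) - E n) atTop
      (𝓝 (maxMultConst k)) := by
    have hcont : Continuous fun z : ℝ => z * Real.exp ((1 - z ^ 2) / 2) := by fun_prop
    have h1 := (hcont.tendsto 1).comp hj1
    have h2 := (h1.const_mul (maxMultConst k)).sub hE0
    simpa using h2
  have hlow_le : ∀ᶠ n in atTop,
      maxMultConst k * (y n * Real.exp ((1 - y n ^ 2) / 2)) - E n ≤ a n := by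
    filter_upwards [eventually_gt_atTop 0] with n hn
    have h1 := (abs_le.1 (hE n hn (d n) (hd n) (j n) (hj n) (y n) rfl)).1
    have h2 : (d n (j n) : ℝ) * n / (k + 1) ^ n ≤ a n := by
      have : (d n (j n) : ℝ) ≤ d n (J n) := by exact_mod_cast hJ n (j n)
      simp only [ha]
      gcongr
    linarith
  -- At the wrong parity the multiplicity vanishes, but the lower bound for the maximum is
  -- eventually positive.
  have hpar : ∀ᶠ n in atTop, (2 : ℤ) ∣ J n - n * k := by
    filter_upwards [hlow_le, hlow.eventually (eventually_gt_nhds hC)] with n h1 h2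
    by_contra hcon
    have h3 := isSpinMultiplicity_eq_zero (hd n) hcon
    simp only [ha, h3] at h1
    simp at h1
    linarith
  have hup : ∀ᶠ n in atTop,
      a n - E n ≤ maxMultConst k * (x n * Real.exp ((1 - x n ^ 2) / 2)) := by
    filter_upwards [eventually_gt_atTop 0, hpar] with n hn hp
    have h1 := (abs_le.1 (hE n hn (d n) (hd n) (J n) hp (x n) rfl)).2
    simp only [ha]
    linarith
  have hup1 : ∀ᶠ n in atTop, a n ≤ maxMultConst k + E n := by
    filter_upwards [hup] with n hn
    have := mul_le_mul_of_nonneg_left (mul_exp_le_one (x n)) hC.le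
    linarith
  have hlim : Tendsto a atTop (𝓝 (maxMultConst k)) :=
    tendsto_of_tendsto_of_tendsto_of_le_of_le' hlow (by simpa using hE0.const_add (maxMultConst k))
      hlow_le hup1
  refine ⟨hlim, tendsto_one_of_mul_exp ?_⟩
  have h1 : Tendsto (fun n => (a n - E n) / maxMultConst k) atTop (𝓝 1) := by
    have := (hlim.sub hE0).div_const (maxMultConst k)
    rwa [sub_zero, div_self hC.ne'] at this
  refine tendsto_of_tendsto_of_tendsto_of_le_of_le' h1 tendsto_const_nhds ?_
    (Eventually.of_forall fun n => mul_exp_le_one _)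
  filter_upwards [hup] with n hn
  rwa [div_le_iff₀ hC, mul_comm]

lemma isEquivalent_of_max_multiplicity (hk : 1 ≤ k) (hd : ∀ n, IsSpinMultiplicity k n (d n))
    (hJ : ∀ n i, d n i ≤ d n (J n)) :
    (fun n : ℕ => (J n : ℝ) / 2) ~[atTop] (fun n : ℕ => Real.sqrt (spinVariance k) * Real.sqrt n) ∧
    (fun n : ℕ => (d n (J n) : ℝ)) ~[atTop]
      (fun n : ℕ => maxMultConst k * (((k : ℝ) + 1) ^ n / n)) := by
  have hC := maxMultConst_pos hk
  have hv : 0 < Real.sqrt (spinVariance k) := Real.sqrt_pos.2 (spinVariance_pos hk)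
  obtain ⟨h1, h2⟩ := tendsto_max_multiplicity hk hd hJ
  constructor
  · refine (isEquivalent_iff_tendsto_one ?_).2 ?_
    · filter_upwards [eventually_gt_atTop 0] with n hn
      have : 0 < Real.sqrt n := Real.sqrt_pos.2 (by exact_mod_cast hn)
      positivity
    · have hsq : Tendsto (fun n : ℕ => 2 * Real.sqrt (spinVariance k) * Real.sqrt n) atTop atTop :=
        (Real.tendsto_sqrt_atTop.comp tendsto_natCast_atTop_atTop).const_mul_atTop (by positivity)
      -- Replacing `J n + 1` by `J n` costs `1/(2√v√n)`, which tends to zero.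
      have h3 := h2.sub ((tendsto_const_nhds (x := (1 : ℝ))).div_atTop hsq)
      rw [sub_zero] at h3
      refine h3.congr' ?_
      filter_upwards [eventually_gt_atTop 0] with n hn
      have : 0 < Real.sqrt n := Real.sqrt_pos.2 (by exact_mod_cast hn)
      simp only [Pi.div_apply]
      field_simp
      ring
  · refine (isEquivalent_iff_tendsto_one ?_).2 ?_
    · filter_upwards [eventually_gt_atTop 0] with n hn
      have : (0 : ℝ) < n := by exact_mod_cast hn
      positivity
    · have h3 := h1.div_const (maxMultConst k)
      rw [div_self hC.ne'] at h3
      refine h3.congr' ?_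
      filter_upwards [eventually_gt_atTop 0] with n hn
      have : (0 : ℝ) < n := by exact_mod_cast hn
      simp only [Pi.div_apply]
      field_simp

end

theorem proposition7 :
    ∃ c C : ℕ → ℝ,
      (∀ k : ℕ, 1 ≤ k →
        0 < c k ∧ 0 < C k ∧
        (∀ n : ℕ, ∃ d : ℕ → ℕ, IsSpinMultiplicity k n d ∧ ∃ j : ℕ, ∀ i : ℕ, d i ≤ d j) ∧
        (∀ (d : ℕ → ℕ → ℕ) (J : ℕ → ℕ),
          (∀ n : ℕ, IsSpinMultiplicity k n (d n)) →
          (∀ n i : ℕ, d n i ≤ d n (J n)) →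
          (fun n : ℕ => (J n : ℝ) / 2) ~[atTop] (fun n : ℕ => c k * Real.sqrt n) ∧
          (fun n : ℕ => (d n (J n) : ℝ)) ~[atTop]
            (fun n : ℕ => C k * (((k : ℝ) + 1) ^ n / n)))) ∧
      (∃ k₁ k₂ : ℕ, 1 ≤ k₁ ∧ 1 ≤ k₂ ∧ c k₁ ≠ c k₂) ∧
      (∃ k₁ k₂ : ℕ, 1 ≤ k₁ ∧ 1 ≤ k₂ ∧ C k₁ ≠ C k₂) := by
  refine ⟨fun k => Real.sqrt (spinVariance k), maxMultConst, fun k hk => ⟨?_, ?_, ?_, ?_⟩, ?_, ?_⟩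
  · exact Real.sqrt_pos.2 (spinVariance_pos hk)
  · exact maxMultConst_pos hk
  · intro n
    obtain ⟨d, hd⟩ := exists_isSpinMultiplicity k n
    exact ⟨d, hd, isSpinMultiplicity_exists_max hd⟩
  · exact fun d J hd hJ => isEquivalent_of_max_multiplicity hk hd hJ
  -- Spins `1/2` and `1` have variances `1/4` and `2/3`, which separates both constants.
  · refine ⟨1, 2, le_rfl, by norm_num, fun h => ?_⟩
    rw [Real.sqrt_inj (spinVariance_pos le_rfl).le (spinVariance_pos (by norm_num)).le] at h
    norm_num [spinVariance] at h
  · refine ⟨1, 2, le_rfl, by norm_num, fun h => ?_⟩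
    have hp := Real.pi_pos
    have h0 : 0 < Real.sqrt (2 * Real.pi * Real.exp 1) := Real.sqrt_pos.2 (by positivity)
    rw [maxMultConst, maxMultConst, one_div, one_div, inv_inj, mul_left_inj' h0.ne'] at h
    norm_num [spinVariance] at h
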